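/- Conventions. Manifolds are smooth, Hausdorff and second countable; Lorentzian metrics have signature $(-,+,\dots,+)$; connections, vector fields, forms and functions are smooth. A vector field $p$ on a Lorentzian manifold $(M,g)$ is \emph{isotropic} if $p_x\neq 0$ and $g(p_x,p_x)=0$ for all $x\in M$; $p^\flat=g(p,\cdot)$. Write $(X\wedge Y)Z=g(X,Z)Y-g(Y,Z)X$, and for a 3-form $S$ let $S(X,Y)$ be the vector with $g(S(X,Y),Z)=S(X,Y,Z)$. A metric connection $\nabla$ (i.e. $\nabla g=0$) \emph{has twistor-free torsion with vectorial component $\xi$ and skew-symmetric component $S$}, where $\xi$ is a vector field and $S$ a 3-form, if its torsion is $$T(X,Y)=(X\wedge Y)\xi+S(X,Y);$$ the torsion is \emph{parallel} if $\nabla T=0$. The 3-form $S$ is \emph{degenerate} if its $g$-norm vanishes, i.e. $S_{ijk}S^{ijk}=0$. If $p$ is an isotropic vector field that is parallel for the Levi-Civita connection $\nabla^g$, then $\nabla^g$ induces a connection, also denoted $\nabla^g$, on the screen bundle $p^\perp/\langle p\rangle$; for a 2-form $\omega$ on this bundle, $p^\flat\wedge\omega$ denotes the 3-form $p^\flat\wedge\tilde\omega$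 on $M$, where $\tilde\omega$ is any extension to $TM$ of the form that $\omega$ defines on $p^\perp$ (the result does not depend on the extension). \textbf{Theorem.} (1) Let $(M_0,g_0)$ be a Lorentzian manifold with a $\nabla^{g_0}$-parallel isotropic vector field $p_0$, a $\nabla^{g_0}$-parallel 2-form $\omega$ on the screen bundle $p_0^\perp/\langle p_0\rangle$ such that $\tau_0=p_0^\flat\wedge\omega$ is $\nabla^{g_0}$-parallel, and a function $\varphi$ on $M_0$ such that $p_0^\flat=d e^{\varphi}$. Let $\xi=e^{-\varphi}p_0$ and $S=e^{-\varphi}\tau_0$. Then $$\nabla_X=\nabla^{g_0}_X+X\wedge\xi+\tfrac12 S(X)\qquad(\ast)$$ is a metric connection on $(M_0,g_0)$ with parallel twistor-free torsion, with isotropic vectorial component $\xi$ and degenerate skew-symmetric component $S$. (2) Conversely, let $(M,g)$ be a simply connected Lorentzian manifold with a metric connection $\nabla$ with parallel twistor-free torsion having isotropic vectorial component $\xi$ and degenerate skew-symmetric component $S$. Then $(M,g,\nabla)$ arises globally from the construction in (1): there are $p_0,\omega,\tau_0,\varphi$ on $(M,g)$ as in (1), with $M_0=M$ and $g_0=g$,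 such that $\xi=e^{-\varphi}p_0$, $S=e^{-\varphi}\tau_0$, and $\nabla$ is the connection $(\ast)$. -/

import Mathlib

open scoped Manifold ContDiff Bundle

set_option linter.unusedSectionVars false

noncomputable section

/-- A smooth Lorentzian metric of signature `(-, +, …, +)` on an `n`-dimensional manifold. -/
structure LorentzianMetric (n : ℕ) (M : Type*) [TopologicalSpace M]
    [ChartedSpace (EuclideanSpace ℝ (Fin n)) M] [IsManifold (𝓡 n) ∞ M] where
  /-- the scalar product on each tangent space -/
  val (x : M) : TangentSpace (𝓡 n) x →L[ℝ] TangentSpace (𝓡 n) x →L[ℝ] ℝ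
  symm (x : M) (u v : TangentSpace (𝓡 n) x) : val x u v = val x v u
  /-- each tangent space has an orthonormal basis with exactly one timelike vector -/
  lorentzian (x : M) : ∃ (b : Module.Basis (Fin n) ℝ (TangentSpace (𝓡 n) x)) (i₀ : Fin n),
    ∀ i j, val x (b i) (b j) = if i = j then (if i = i₀ then -1 else 1) else 0
  contMDiff : ContMDiff (𝓡 n) ((𝓡 n).prod
      𝓘(ℝ, EuclideanSpace ℝ (Fin n) →L[ℝ] EuclideanSpace ℝ (Fin n) →L[ℝ] ℝ)) ∞
    (fun x ↦ Bundle.TotalSpace.mk'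
      (EuclideanSpace ℝ (Fin n) →L[ℝ] EuclideanSpace ℝ (Fin n) →L[ℝ] ℝ)
      (E := fun x : M ↦ TangentSpace (𝓡 n) x →L[ℝ] TangentSpace (𝓡 n) x →L[ℝ] ℝ) x (val x))

/-- Connections on the tangent bundle. In Mathlib's convention, `D Y x v` is `(∇_v Y)(x)`. -/
abbrev AffineConnection (n : ℕ) (M : Type*) [TopologicalSpace M]
    [ChartedSpace (EuclideanSpace ℝ (Fin n)) M] [IsManifold (𝓡 n) ∞ M] :=
  CovariantDerivative (𝓡 n) (EuclideanSpace ℝ (Fin n)) (TangentSpace (𝓡 n) : M → Type _)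

namespace LorentzianMetric

variable {n : ℕ} {M : Type*} [TopologicalSpace M]
  [ChartedSpace (EuclideanSpace ℝ (Fin n)) M] [IsManifold (𝓡 n) ∞ M]

/-! ### Pointwise algebra -/

instance finiteDimensional_tangent (x : M) : FiniteDimensional ℝ (TangentSpace (𝓡 n) x) :=
  inferInstanceAs (FiniteDimensional ℝ (EuclideanSpace ℝ (Fin n)))

instance t2Space_tangent (x : M) : T2Space (TangentSpace (𝓡 n) x) :=
  inferInstanceAs (T2Space (EuclideanSpace ℝ (Fin n)))

/-- The metric at `x` as a linear map from the tangent space to its dual. -/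
def bilin (g : LorentzianMetric n M) (x : M) : LinearMap.BilinForm ℝ (TangentSpace (𝓡 n) x) :=
  LinearMap.mk₂ ℝ (fun u v ↦ g.val x u v) (by simp) (by simp) (by simp) (by simp)

theorem bilin_nondegenerate (g : LorentzianMetric n M) (x : M) : (g.bilin x).Nondegenerate := by
  have key : ∀ u, (∀ v, g.val x u v = 0) → u = 0 := by
    intro u hu
    obtain ⟨b, i₀, hb⟩ := g.lorentzian x
    apply b.ext_elem
    intro j
    have h := hu (b j)
    rw [← b.sum_repr u] at h
    simp only [map_sum, map_smul, FunLike.coe_sum, Finset.sum_apply, FunLike.coe_smul,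
      Pi.smul_apply, hb, smul_eq_mul, mul_ite, mul_zero, Finset.sum_ite_eq', Finset.mem_univ,
      if_true] at h
    split_ifs at h <;> simpa using h
  exact ⟨key, fun u hu ↦ key u fun v ↦ (g.symm x u v).trans (hu v)⟩

/-- The vector `α^♯` with `g(α^♯, ·) = α`. -/
def sharp (g : LorentzianMetric n M) (x : M) :
    Module.Dual ℝ (TangentSpace (𝓡 n) x) ≃ₗ[ℝ] TangentSpace (𝓡 n) x :=
  ((g.bilin x).toDual (g.bilin_nondegenerate x)).symm

theorem val_sharp (g : LorentzianMetric n M) (x : M) (α : Module.Dual ℝ (TangentSpace (𝓡 n) x))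
    (v : TangentSpace (𝓡 n) x) : g.val x (g.sharp x α) v = α v :=
  LinearMap.BilinForm.apply_toDual_symm_apply (B := g.bilin x) α v

/-- The vector `S(u, v)` defined by `g(S(u, v), w) = S(u, v, w)`. -/
def formVec (g : LorentzianMetric n M) (x : M) (S : TangentSpace (𝓡 n) x [⋀^Fin 3]→L[ℝ] ℝ)
    (u v : TangentSpace (𝓡 n) x) : TangentSpace (𝓡 n) x :=
  g.sharp x (S.toMultilinearMap.toLinearMap ![u, v, 0] 2)

theorem val_formVec (g : LorentzianMetric n M) (x : M)
    (S : TangentSpace (𝓡 n) x [⋀^Fin 3]→L[ℝ] ℝ) (u v w : TangentSpace (𝓡 n) x) :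
    g.val x (g.formVec x S u v) w = S ![u, v, w] := by
  rw [formVec, val_sharp]
  change S (Function.update ![u, v, 0] 2 w) = _
  congr 1
  ext i
  fin_cases i <;> simp

theorem eq_of_val_eq (g : LorentzianMetric n M) (x : M) {u v : TangentSpace (𝓡 n) x}
    (h : ∀ w, g.val x u w = g.val x v w) : u = v := by
  have := (g.bilin_nondegenerate x).1 (u - v) fun w ↦ by
    change g.val x (u - v) w = 0
    simp [h w]
  exact sub_eq_zero.mp this

theorem update_snd {V : Type*} (u v w z : V) :
    Function.update ![u, z, w] (1 : Fin 3) v = ![u, v, w] := by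
  ext i
  fin_cases i <;> simp

theorem form_add_snd (x : M) (S : TangentSpace (𝓡 n) x [⋀^Fin 3]→L[ℝ] ℝ)
    (u v v' w : TangentSpace (𝓡 n) x) : S ![u, v + v', w] = S ![u, v, w] + S ![u, v', w] := by
  have h := S.map_update_add ![u, 0, w] 1 v v'
  rwa [update_snd, update_snd, update_snd] at h

theorem form_smul_snd (x : M) (S : TangentSpace (𝓡 n) x [⋀^Fin 3]→L[ℝ] ℝ) (c : ℝ)
    (u v w : TangentSpace (𝓡 n) x) : S ![u, c • v, w] = c • S ![u, v, w] := by
  have h := S.map_update_smul ![u, 0, w] 1 c v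
  rwa [update_snd, update_snd] at h

/-- The squared `g`-norm `g(S, S) = S_{ijk} S^{ijk}` of a 3-form at `x`: the first factor is
evaluated on a basis and the second one on the `g`-dual basis (the value does not depend on
the basis). -/
def formNormSq (g : LorentzianMetric n M) (x : M) (S : TangentSpace (𝓡 n) x [⋀^Fin 3]→L[ℝ] ℝ) :
    ℝ :=
  let b := Module.finBasis ℝ (TangentSpace (𝓡 n) x)
  ∑ i, ∑ j, ∑ k, S ![b i, b j, b k] *
    S ![g.sharp x (b.coord i), g.sharp x (b.coord j), g.sharp x (b.coord k)]

end LorentzianMetric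

section

variable {n : ℕ} {M : Type*} [TopologicalSpace M]
  [ChartedSpace (EuclideanSpace ℝ (Fin n)) M] [IsManifold (𝓡 n) ∞ M]

/-! ### Fields on the manifold -/

/-- The vector field `X` is smooth at `x`. -/
def IsSmoothFieldAt (X : ∀ x : M, TangentSpace (𝓡 n) x) (x : M) : Prop :=
  ContMDiffAt (𝓡 n) ((𝓡 n).prod 𝓘(ℝ, EuclideanSpace ℝ (Fin n))) ∞
    (fun y ↦ (⟨y, X y⟩ : TangentBundle (𝓡 n) M)) x

/-- The vector field `X` is differentiable at `x`. -/
def IsDiffFieldAt (X : ∀ x : M, TangentSpace (𝓡 n) x) (x : M) : Prop :=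
  MDifferentiableAt (𝓡 n) ((𝓡 n).prod 𝓘(ℝ, EuclideanSpace ℝ (Fin n)))
    (fun y ↦ (⟨y, X y⟩ : TangentBundle (𝓡 n) M)) x

/-- `X` is a smooth vector field. -/
def IsSmoothField (X : ∀ x : M, TangentSpace (𝓡 n) x) : Prop := ∀ x, IsSmoothFieldAt X x

/-- `X` is an isotropic vector field: nowhere zero and null at every point. -/
def IsIsotropic (g : LorentzianMetric n M) (X : ∀ x : M, TangentSpace (𝓡 n) x) : Prop :=
  ∀ x, X x ≠ 0 ∧ g.val x (X x) (X x) = 0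

/-- `S` is a smooth 3-form: its values on vector fields that are smooth at a point are smooth
there. -/
def IsSmoothThreeForm (S : ∀ x : M, TangentSpace (𝓡 n) x [⋀^Fin 3]→L[ℝ] ℝ) : Prop :=
  ∀ (x : M) (X Y Z : ∀ y : M, TangentSpace (𝓡 n) y),
    IsSmoothFieldAt X x → IsSmoothFieldAt Y x → IsSmoothFieldAt Z x →
      ContMDiffAt (𝓡 n) 𝓘(ℝ) ∞ (fun y ↦ S y ![X y, Y y, Z y]) x

/-- A 3-form `S` is degenerate if its `g`-norm is zero. -/
def IsDegenerateForm (g : LorentzianMetric n M)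
    (S : ∀ x : M, TangentSpace (𝓡 n) x [⋀^Fin 3]→L[ℝ] ℝ) : Prop :=
  ∀ x, g.formNormSq x (S x) = 0

/-! ### Connections -/

/-- `∇ g = 0`. -/
def IsMetricConnection (g : LorentzianMetric n M) (D : AffineConnection n M) : Prop :=
  ∀ (x : M) (Y Z : ∀ y : M, TangentSpace (𝓡 n) y), IsDiffFieldAt Y x → IsDiffFieldAt Z x →
    ∀ v : TangentSpace (𝓡 n) x,
      mvfderiv (𝓡 n) (fun y ↦ g.val y (Y y) (Z y)) x v =
        g.val x (D Y x v) (Z x) + g.val x (Y x) (D Z x v)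

/-- `D` is the Levi-Civita connection of `g`: smooth, metric and torsion-free. -/
structure IsLeviCivita (g : LorentzianMetric n M) (D : AffineConnection n M) : Prop where
  smooth : CovariantDerivative.ContMDiffCovariantDerivative D ∞
  metric : IsMetricConnection g D
  torsion_eq_zero : D.torsion = 0

/-- `∇ X = 0` for a vector field `X`. -/
def IsParallelField (D : AffineConnection n M) (X : ∀ x : M, TangentSpace (𝓡 n) x) : Prop :=
  ∀ x, D X x = 0

/-- `∇ S = 0` for a 3-form `S`. -/
def IsParallelThreeForm (D : AffineConnection n M)
    (S : ∀ x : M, TangentSpace (𝓡 n) x [⋀^Fin 3]→L[ℝ] ℝ) : Prop :=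
  ∀ (x : M) (X Y Z : ∀ y : M, TangentSpace (𝓡 n) y),
    IsSmoothFieldAt X x → IsSmoothFieldAt Y x → IsSmoothFieldAt Z x →
    ∀ v : TangentSpace (𝓡 n) x,
      mvfderiv (𝓡 n) (fun y ↦ S y ![X y, Y y, Z y]) x v =
        S x ![D X x v, Y x, Z x] + S x ![X x, D Y x v, Z x] + S x ![X x, Y x, D Z x v]

/-- `∇ T = 0` for the torsion `T` of `∇`. -/
def HasParallelTorsion (D : AffineConnection n M) : Prop :=
  ∀ (x : M) (Y Z : ∀ y : M, TangentSpace (𝓡 n) y),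
    IsSmoothFieldAt Y x → IsSmoothFieldAt Z x → ∀ v : TangentSpace (𝓡 n) x,
      D (fun y ↦ D.torsion y (Y y) (Z y)) x v =
        D.torsion x (D Y x v) (Z x) + D.torsion x (Y x) (D Z x v)

/-- `D` is a (smooth) metric connection whose torsion is parallel and has vectorial component
`ξ`, skew-symmetric component `S` and zero twistorial component, that is,
`T(u, v) = g(u, ξ) v - g(v, ξ) u + S(u, v)`. -/
structure IsMetricWithParallelTwistorFreeTorsion (g : LorentzianMetric n M)
    (D : AffineConnection n M) (ξ : ∀ x : M, TangentSpace (𝓡 n) x)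
    (S : ∀ x : M, TangentSpace (𝓡 n) x [⋀^Fin 3]→L[ℝ] ℝ) : Prop where
  smooth : CovariantDerivative.ContMDiffCovariantDerivative D ∞
  metric : IsMetricConnection g D
  smooth_vectorial : IsSmoothField ξ
  smooth_skew : IsSmoothThreeForm S
  torsion_eq : ∀ (x : M) (u v : TangentSpace (𝓡 n) x),
    D.torsion x u v = g.val x u (ξ x) • v - g.val x v (ξ x) • u + g.formVec x (S x) u v
  parallel : HasParallelTorsion D

/-- The tensor `(v, u) ↦ (u ∧ ξ) v + ½ S(u, v)`, where `(u ∧ ξ) v = g(u, v) ξ - g(ξ, v) u`. -/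
def contorsion (g : LorentzianMetric n M) (ξ : ∀ x : M, TangentSpace (𝓡 n) x)
    (S : ∀ x : M, TangentSpace (𝓡 n) x [⋀^Fin 3]→L[ℝ] ℝ) (x : M) :
    TangentSpace (𝓡 n) x →L[ℝ] TangentSpace (𝓡 n) x →L[ℝ] TangentSpace (𝓡 n) x :=
  LinearMap.toContinuousBilinearMap <| LinearMap.mk₂ ℝ
    (fun v u ↦ g.val x u v • ξ x - g.val x (ξ x) v • u + (1 / 2 : ℝ) • g.formVec x (S x) u v)
    (by
      intro v v' u
      refine g.eq_of_val_eq x fun w ↦ ?_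
      have h := LorentzianMetric.form_add_snd x (S x) u v v' w
      simp [LorentzianMetric.val_formVec, h]
      ring)
    (by
      intro c v u
      refine g.eq_of_val_eq x fun w ↦ ?_
      have h := LorentzianMetric.form_smul_snd x (S x) c u v w
      simp [LorentzianMetric.val_formVec, h]
      ring)
    (by
      intro v u u'
      refine g.eq_of_val_eq x fun w ↦ ?_
      have h := (S x).vecCons_add ![v, w] u u'
      simp [LorentzianMetric.val_formVec, h]
      ring)
    (by
      intro c v u
      refine g.eq_of_val_eq x fun w ↦ ?_
      have h := (S x).vecCons_smul ![v, w] c u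
      simp [LorentzianMetric.val_formVec, h]
      ring)

/-- The connection `∇_X Y = ∇^g_X Y + (X ∧ ξ) Y + ½ S(X, Y)`, for a connection `D = ∇^g`. -/
def torsionConnection (g : LorentzianMetric n M) (D : AffineConnection n M)
    (ξ : ∀ x : M, TangentSpace (𝓡 n) x)
    (S : ∀ x : M, TangentSpace (𝓡 n) x [⋀^Fin 3]→L[ℝ] ℝ) : AffineConnection n M :=
  D.addOneForm (contorsion g ξ S)

theorem torsionConnection_apply (g : LorentzianMetric n M) (D : AffineConnection n M)
    (ξ : ∀ x : M, TangentSpace (𝓡 n) x)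
    (S : ∀ x : M, TangentSpace (𝓡 n) x [⋀^Fin 3]→L[ℝ] ℝ)
    (Y : ∀ x : M, TangentSpace (𝓡 n) x) (x : M) (u : TangentSpace (𝓡 n) x) :
    torsionConnection g D ξ S Y x u = D Y x u +
      (g.val x u (Y x) • ξ x - g.val x (ξ x) (Y x) • u
        + (1 / 2 : ℝ) • g.formVec x (S x) u (Y x)) :=
  rfl

/-! ### The screen bundle -/

/-- The hyperplane `p^⊥` of the tangent space at `x`. -/
def perp (g : LorentzianMetric n M) (p : ∀ x : M, TangentSpace (𝓡 n) x) (x : M) :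
    Submodule ℝ (TangentSpace (𝓡 n) x) :=
  LinearMap.ker (g.bilin x (p x))

/-- The fibre `p^⊥ / ⟨p⟩` of the screen bundle at `x`, for an isotropic vector field `p`. -/
abbrev Screen (g : LorentzianMetric n M) (p : ∀ x : M, TangentSpace (𝓡 n) x) (x : M) : Type :=
  perp g p x ⧸ (Submodule.span ℝ {p x}).submoduleOf (perp g p x)

/-- The projection `p^⊥ → p^⊥ / ⟨p⟩`. -/
def toScreen (g : LorentzianMetric n M) (p : ∀ x : M, TangentSpace (𝓡 n) x) (x : M) :
    perp g p x →ₗ[ℝ] Screen g p x :=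
  Submodule.mkQ _

/-- `η` is a smooth 2-form on the screen bundle: its values on sections of `p^⊥` that are smooth
at a point are smooth there. -/
def IsSmoothScreenForm (g : LorentzianMetric n M) (p : ∀ x : M, TangentSpace (𝓡 n) x)
    (η : ∀ x : M, Screen g p x [⋀^Fin 2]→ₗ[ℝ] ℝ) : Prop :=
  ∀ (x : M) (Y Z : ∀ y : M, perp g p y),
    IsSmoothFieldAt (fun y ↦ (Y y : TangentSpace (𝓡 n) y)) x →
    IsSmoothFieldAt (fun y ↦ (Z y : TangentSpace (𝓡 n) y)) x →
      ContMDiffAt (𝓡 n) 𝓘(ℝ) ∞ (fun y ↦ η y ![toScreen g p y (Y y), toScreen g p y (Z y)]) x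

/-- `η` is parallel for the connection induced by `D` on the screen bundle, which sends the class
of a section `Y` of `p^⊥` to the class of `D_v Y`. (If `D` is metric and `p` is parallel then
`D_v Y` lies in `p^⊥`; it is written as the element `Y'` of `p^⊥` below, and likewise for `Z`.) -/
def IsParallelScreenForm (g : LorentzianMetric n M) (D : AffineConnection n M)
    (p : ∀ x : M, TangentSpace (𝓡 n) x) (η : ∀ x : M, Screen g p x [⋀^Fin 2]→ₗ[ℝ] ℝ) : Prop :=
  ∀ (x : M) (Y Z : ∀ y : M, perp g p y),
    IsSmoothFieldAt (fun y ↦ (Y y : TangentSpace (𝓡 n) y)) x →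
    IsSmoothFieldAt (fun y ↦ (Z y : TangentSpace (𝓡 n) y)) x →
    ∀ v : TangentSpace (𝓡 n) x, ∃ Y' Z' : perp g p x,
      (Y' : TangentSpace (𝓡 n) x) = D (fun y ↦ (Y y : TangentSpace (𝓡 n) y)) x v ∧
      (Z' : TangentSpace (𝓡 n) x) = D (fun y ↦ (Z y : TangentSpace (𝓡 n) y)) x v ∧
      mvfderiv (𝓡 n) (fun y ↦ η y ![toScreen g p y (Y y), toScreen g p y (Z y)]) x v =
        η x ![toScreen g p x Y', toScreen g p x (Z x)] +
          η x ![toScreen g p x (Y x), toScreen g p x Z']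

/-- `τ = p^♭ ∧ η` for a 2-form `η` on the screen bundle: `τ_x = p^♭ ∧ β` for an extension `β` of
`η_x` to a 2-form on the tangent space (`p^♭ ∧ β` does not depend on the extension). -/
def IsFlatWedge (g : LorentzianMetric n M) (p : ∀ x : M, TangentSpace (𝓡 n) x)
    (η : ∀ x : M, Screen g p x [⋀^Fin 2]→ₗ[ℝ] ℝ)
    (τ : ∀ x : M, TangentSpace (𝓡 n) x [⋀^Fin 3]→L[ℝ] ℝ) : Prop :=
  ∀ x : M, ∃ β : TangentSpace (𝓡 n) x [⋀^Fin 2]→L[ℝ] ℝ,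
    (∀ Y Z : perp g p x, β ![(Y : TangentSpace (𝓡 n) x), (Z : TangentSpace (𝓡 n) x)] =
      η x ![toScreen g p x Y, toScreen g p x Z]) ∧
    ∀ u v w : TangentSpace (𝓡 n) x, τ x ![u, v, w] =
      g.val x (p x) u * β ![v, w] + g.val x (p x) v * β ![w, u] + g.val x (p x) w * β ![u, v]

/-- The data of the construction: the Levi-Civita connection `D` of `g`, a parallel isotropic
vector field `p`, a parallel 2-form `η` on its screen bundle, the 3-form `τ = p^♭ ∧ η`, which is
parallel, and a smooth function `φ` with `p^♭ = d e^φ`. -/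
structure IsConstructionData (g : LorentzianMetric n M) (D : AffineConnection n M)
    (p : ∀ x : M, TangentSpace (𝓡 n) x) (η : ∀ x : M, Screen g p x [⋀^Fin 2]→ₗ[ℝ] ℝ)
    (τ : ∀ x : M, TangentSpace (𝓡 n) x [⋀^Fin 3]→L[ℝ] ℝ) (φ : M → ℝ) : Prop where
  leviCivita : IsLeviCivita g D
  smooth_field : IsSmoothField p
  isotropic : IsIsotropic g p
  parallel_field : IsParallelField D p
  smooth_screenForm : IsSmoothScreenForm g p η
  parallel_screenForm : IsParallelScreenForm g D p η
  wedge : IsFlatWedge g p η τ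
  smooth_form : IsSmoothThreeForm τ
  parallel_form : IsParallelThreeForm D τ
  smooth_potential : ContMDiff (𝓡 n) 𝓘(ℝ) ∞ φ
  flat_eq : ∀ (x : M) (v : TangentSpace (𝓡 n) x),
    g.val x (p x) v = mvfderiv (𝓡 n) (fun y ↦ Real.exp (φ y)) x v

end

end

/-! Both directions rest on the pointwise shape of the torsion: `S(ξ, ·, ·) = 0` and `S` vanishes on
`ξ^⊥`, that is, `S = ξ^♭ ∧ β` with `β` coming from the screen.

For such `S` the contorsion `K_v = v ∧ ξ + ½ S(v, ·)` satisfies `K_v ξ = g(ξ, v) ξ`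
(`contorsion_self`), and inserting `K_v` into the three slots of `S` gives `-g(ξ, v) S` in total
(`form_contorsion`). The connection with contorsion and the Levi-Civita connection therefore differ
on `ξ` and on `S` by multiples of `ξ^♭ = dφ`, and these are exactly what the factors `e^{±φ}`
absorb. So `ξ, S` are parallel for the former if and only if `e^φ ξ, e^φ S` are parallel for the
latter. Since the torsion is built from `g`, `ξ` and `S`, this gives the direct part.

For the converse, `∇T = 0` first splits into `∇ξ = 0` and `∇S = 0`. The curvature `R` then kills `ξ`
and annihilates `S`, and the first Bianchi identity expresses its cyclic sum by `T(T(·,·),·)`. The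
main point is that this forces the shape of `S` (`eq_zero_of_curvature`):

Pairing Bianchi with `ξ` removes the curvature and leaves an identity for the skew endomorphism `A_ξ
= S(ξ, ·)`. Contracting it with `S` gives `|A_ξ|² = 0`. As `A_ξ ξ = 0`, this norm only sees the
positive definite screen, so the 2-form `A_ξ` vanishes on `ξ^⊥` and is determined by one vector `a`
orthogonal to `ξ`. The degeneracy condition becomes `|S restricted to the screen|² = 6 |a|²`. If `a`
were nonzero, Bianchi in the directions `ζ, y, a` would force `|y|² = 0` for each `y` orthogonal to
`ξ` and `a`. The screen would be a line, carrying no 3-form, and the norm condition would give `a =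
0` after all. Hence `a = 0`, and then the screen part of `S` vanishes too.

It follows that `dξ^♭(u, v) = g(ξ, T(u, v)) = 0`, so simple connectedness provides `φ` with `dφ =
ξ^♭`. The data are `p₀ = e^φ ξ`, `τ₀ = e^φ S`, with the contorsion subtracted from the connection,
and the screen form is the contraction of `τ₀` with any `ζ` such that `g(p₀, ζ) = 1`. -/

noncomputable section

/-! ### Null frames of a Lorentzian scalar product -/

section NullFrame

variable {V : Type*} [AddCommGroup V] [Module ℝ V]

/-- A frame `ξ, ζ, e i` adapted to a null vector `ξ`: `ζ` is null with `B ξ ζ = 1`, and the `e i`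
are orthogonal spacelike vectors orthogonal to `ξ` and `ζ`. -/
structure IsNullFrame (B : LinearMap.BilinForm ℝ V) (ξ ζ : V) {ι : Type*} [Fintype ι]
    (e : ι → V) : Prop where
  symm (u v : V) : B u v = B v u
  null_left : B ξ ξ = 0
  null_right : B ζ ζ = 0
  pairing : B ξ ζ = 1
  pos (i : ι) : 0 < B (e i) (e i)
  ortho_left (i : ι) : B (e i) ξ = 0
  ortho_right (i : ι) : B (e i) ζ = 0
  expand (v : V) : v = B v ζ • ξ + B v ξ • ζ + ∑ i, (B v (e i) / B (e i) (e i)) • e i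

/-- The timelike basis vector lies in the span of `ξ` and `ζ`, so the orthogonal complement of that
plane is positive definite and has an orthogonal basis. Normalization is not needed: the squared
lengths appear as denominators in the expansion. -/
theorem exists_isNullFrame {n : ℕ} (B : LinearMap.BilinForm ℝ V) (hsymm : ∀ u v, B u v = B v u)
    (b : Module.Basis (Fin n) ℝ V) (i₀ : Fin n)
    (hb : ∀ i j, B (b i) (b j) = if i = j then (if i = i₀ then -1 else 1) else 0)
    {ξ : V} (hξ : ξ ≠ 0) (hnull : B ξ ξ = 0) :
    ∃ (ζ : V) (m : ℕ) (e : Fin m → V), IsNullFrame B ξ ζ e := by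
  have hfin : FiniteDimensional ℝ V := Module.Finite.of_basis b
  have hbv : ∀ v j, B v (b j) = b.repr v j * (if j = i₀ then -1 else 1) := by
    intro v j
    conv_lhs => rw [← b.sum_repr v]
    simp only [map_sum, map_smul, LinearMap.sum_apply, LinearMap.smul_apply, smul_eq_mul, hb]
    rw [Finset.sum_eq_single j (fun i _ hi ↦ by simp [hi]) (by simp)]
    simp
  have hvv : ∀ v, B v v = ∑ j, b.repr v j * (b.repr v j * (if j = i₀ then -1 else 1)) := by
    intro v
    conv_lhs => arg 2; rw [← b.sum_repr v]
    simp only [map_sum, map_smul, smul_eq_mul, hbv]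
  have hpos : ∀ v, b.repr v i₀ = 0 → B v v = ∑ j, b.repr v j * b.repr v j := by
    intro v hv
    rw [hvv]
    refine Finset.sum_congr rfl fun j _ ↦ ?_
    by_cases hj : j = i₀
    · simp [hj, hv]
    · simp [hj]
  have hdef : ∀ v, b.repr v i₀ = 0 → B v v = 0 → v = 0 := by
    intro v hv h0
    rw [hpos v hv, Finset.sum_eq_zero_iff_of_nonneg fun j _ ↦ mul_self_nonneg _] at h0
    apply b.ext_elem
    intro j
    simpa using h0 j (Finset.mem_univ j)
  set c := b.repr ξ i₀ with hc
  have hc0 : c ≠ 0 := fun h ↦ hξ (hdef ξ h hnull)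
  have hξb : B ξ (b i₀) = -c := by simp [hbv, hc]
  have hbξ : B (b i₀) ξ = -c := by rw [hsymm, hξb]
  have hbb : B (b i₀) (b i₀) = -1 := by simp [hb]
  -- Subtracting `b i₀ / c` makes the pairing with `ξ` equal to `1`; the multiple of `ξ` then
  -- corrects the square norm from `-1 / c²` to `0`.
  set ζ : V := (1 / (2 * c ^ 2)) • ξ - (1 / c) • b i₀ with hζ
  have hξζ : B ξ ζ = 1 := by
    simp only [hζ, map_sub, map_smul, smul_eq_mul, hnull, hξb]
    field_simp
    ring
  have hζζ : B ζ ζ = 0 := by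
    simp only [hζ, map_sub, map_smul, LinearMap.sub_apply, LinearMap.smul_apply, smul_eq_mul,
      hnull, hξb, hbξ, hbb]
    field_simp
    ring
  let W : Submodule ℝ V := LinearMap.ker (B ξ) ⊓ LinearMap.ker (B ζ)
  have hW : ∀ w : W, B ξ w = 0 ∧ B ζ w = 0 := fun w ↦ ⟨w.2.1, w.2.2⟩
  -- Orthogonality to both `ξ` and `ζ` forces orthogonality to the timelike vector `b i₀`.
  have hW0 : ∀ w : W, b.repr (w : V) i₀ = 0 := by
    intro w
    have h1 : B ζ w = (1 / (2 * c ^ 2)) * B ξ w - (1 / c) * B (b i₀) w := by simp [hζ]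
    rw [(hW w).1, (hW w).2, hsymm (b i₀), hbv] at h1
    simpa [hc0] using h1
  obtain ⟨v, hv⟩ := LinearMap.BilinForm.exists_orthogonal_basis (B := B.restrict W)
    ⟨fun x y ↦ by simpa using hsymm x y⟩
  have hvpos : ∀ i, 0 < B (v i : V) (v i) := by
    intro i
    have h1 : 0 ≤ B (v i : V) (v i) := by
      rw [hpos _ (hW0 _)]
      exact Finset.sum_nonneg fun j _ ↦ mul_self_nonneg _
    refine lt_of_le_of_ne h1 fun h2 ↦ v.ne_zero i ?_
    exact Subtype.ext (hdef _ (hW0 _) h2.symm)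
  refine ⟨ζ, _, fun i ↦ (v i : V), hsymm, hnull, hζζ, hξζ, hvpos,
    fun i ↦ by rw [hsymm]; exact (hW _).1, fun i ↦ by rw [hsymm]; exact (hW _).2, fun x ↦ ?_⟩
  have hmem : x - B x ζ • ξ - B x ξ • ζ ∈ W := by
    refine ⟨?_, ?_⟩
    · simp [hnull, hξζ, hsymm x ξ]
    · simp [hζζ, hsymm ζ ξ, hξζ, hsymm x ζ]
  set w : W := ⟨_, hmem⟩ with hw
  have hsum : ∀ w : W, (w : V) = ∑ j, v.repr w j • (v j : V) := fun w ↦ by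
    simpa only [AddSubmonoidClass.coe_finsetSum, Submodule.coe_smul] using
      congrArg Subtype.val (v.sum_repr w).symm
  have hrepr : ∀ i, v.repr w i = B x (v i) / B (v i : V) (v i) := by
    intro i
    have h1 : B (w : V) (v i) = B x (v i) := by
      simp [hw, (hW (v i)).1, (hW (v i)).2]
    rw [← h1, eq_div_iff (hvpos i).ne']
    have h2 := hsum w
    conv_rhs => rw [h2]
    simp only [map_sum, map_smul, LinearMap.sum_apply, LinearMap.smul_apply, smul_eq_mul]
    rw [Finset.sum_eq_single i]
    · intro j _ hj
      have h3 : B (v j : V) (v i) = 0 := hv hj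
      rw [h3, mul_zero]
    · simp
  have h3 : (w : V) = ∑ i, (B x (v i) / B (v i : V) (v i)) • (v i : V) := by
    simp only [hsum w, hrepr]
  rw [← h3]
  simp [hw]

end NullFrame

/-! ### Contractions over dual bases -/

section Contraction

variable {V : Type*} [AddCommGroup V] [Module ℝ V] {B : LinearMap.BilinForm ℝ V} {ξ ζ : V}
  {ι : Type*} [Fintype ι] {e : ι → V} {κ : Type*} [Fintype κ]

/-- `∑ b i ⊗ b' i` is the inverse metric, which in the null frame reads `ξ ⊗ ζ + ζ ⊗ ξ + ∑ e k ⊗ e k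
/ |e k|²`. This turns basis contractions into sums whose screen part has a sign. -/
theorem IsNullFrame.sum_dual (h : IsNullFrame B ξ ζ e) (b : Module.Basis κ ℝ V) {b' : κ → V}
    (hb' : ∀ i v, B (b' i) v = b.coord i v) (F : V →ₗ[ℝ] V →ₗ[ℝ] ℝ) :
    ∑ i, F (b i) (b' i) = F ξ ζ + F ζ ξ + ∑ k, F (e k) (e k) / B (e k) (e k) := by
  have hsum : ∀ v w, ∑ i, B (b' i) v * F (b i) w = F v w := by
    intro v w
    conv_rhs => rw [← b.sum_repr v]
    simp only [map_sum, map_smul, LinearMap.sum_apply, LinearMap.smul_apply, smul_eq_mul, hb',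
      Module.Basis.coord_apply]
  have h1 : ∀ i, F (b i) (b' i) = B (b' i) ζ * F (b i) ξ + B (b' i) ξ * F (b i) ζ +
      ∑ k, B (b' i) (e k) * F (b i) (e k) / B (e k) (e k) := by
    intro i
    conv_lhs => arg 2; rw [h.expand (b' i)]
    simp only [map_add, map_smul, map_sum, smul_eq_mul]
    congr 1
    exact Finset.sum_congr rfl fun k _ ↦ by ring
  simp only [h1, Finset.sum_add_distrib, hsum]
  rw [Finset.sum_comm]
  simp only [← Finset.sum_div, hsum]
  ring

theorem IsNullFrame.sum_dual_swap (h : IsNullFrame B ξ ζ e) (b : Module.Basis κ ℝ V) {b' : κ → V}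
    (hb' : ∀ i v, B (b' i) v = b.coord i v) (F : V →ₗ[ℝ] V →ₗ[ℝ] ℝ) :
    ∑ i, F (b i) (b' i) = ∑ i, F (b' i) (b i) := by
  have h2 := h.sum_dual b hb' F.flip
  simp only [LinearMap.flip_apply] at h2
  rw [h.sum_dual b hb' F, h2]
  ring

theorem sum_dual_mul (b : Module.Basis κ ℝ V) {b' : κ → V}
    (hb' : ∀ i v, B (b' i) v = b.coord i v) (f : V →ₗ[ℝ] ℝ) (v : V) :
    ∑ i, f (b i) * B (b' i) v = f v := by
  conv_rhs => rw [← b.sum_repr v]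
  simp only [map_sum, map_smul, smul_eq_mul, hb', Module.Basis.coord_apply, mul_comm]

end Contraction

/-! ### Skew-symmetric torsion in a null frame -/

/-- `A` is the vector-valued form of a 3-form `B (A u v) w`. -/
structure IsSkewProduct {V : Type*} [AddCommGroup V] [Module ℝ V] (B : LinearMap.BilinForm ℝ V)
    (A : V →ₗ[ℝ] V →ₗ[ℝ] V) : Prop where
  skew (u v : V) : A u v = -A v u
  skew_right (u v w : V) : B (A u v) w = -B (A u w) v

namespace IsSkewProduct

variable {V : Type*} [AddCommGroup V] [Module ℝ V] {B : LinearMap.BilinForm ℝ V}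
  {A : V →ₗ[ℝ] V →ₗ[ℝ] V} {ξ ζ : V} {ι : Type*} [Fintype ι] {e : ι → V} {κ : Type*} [Fintype κ]

theorem val_skew (hA : IsSkewProduct B A) (u v w : V) : B (A u v) w = -B (A v u) w := by
  rw [hA.skew]; simp

theorem val_cycle (hA : IsSkewProduct B A) (u v w : V) : B (A u v) w = B (A v w) u := by
  rw [hA.val_skew, hA.skew_right]; simp

theorem val_self (hA : IsSkewProduct B A) (u v : V) : B (A u v) v = 0 := by
  have := hA.skew_right u v v
  linarith

theorem val_self' (hA : IsSkewProduct B A) (u v : V) : B (A u v) u = 0 := by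
  have := hA.val_skew u v u
  rw [hA.val_self] at this
  linarith

theorem val_diag (hA : IsSkewProduct B A) (u v : V) : B (A u u) v = 0 := by
  have := hA.val_skew u u v
  linarith

/-- If the action of the endomorphism `A ξ` on the 3-form is proportional to `ξ ∧ A ξ`, then the
2-form `A ξ` vanishes on `ξ^⊥`. -/
theorem contraction_eq_zero (hA : IsSkewProduct B A) (h : IsNullFrame B ξ ζ e)
    (b : Module.Basis κ ℝ V) {b' : κ → V} (hb' : ∀ i v, B (b' i) v = b.coord i v)
    (hstar : ∀ u v w, B (A u v) (A ξ w) + B (A v w) (A ξ u) + B (A w u) (A ξ v) =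
      2 * (B u ξ * B (A ξ v) w + B v ξ * B (A ξ w) u + B w ξ * B (A ξ u) v))
    {u v : V} (hu : B u ξ = 0) (hv : B v ξ = 0) : B (A ξ u) v = 0 := by
  -- `N` is the squared norm of `A ξ`
  set N : ℝ := ∑ j, ∑ k, B (A ξ (b j)) (b k) * B (A ξ (b' j)) (b' k) with hN
  set P : ℝ := ∑ j, ∑ k, B (A (b j) (b k)) (A ξ (A (b' j) (b' k))) with hP
  -- `A ξ` is skew for `B`, while exchanging `b` with its dual basis does not change a contraction;
  -- together they give `P = -P`.
  have hP0 : P = 0 := by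
    have hneg : ∀ x y, B x (A ξ y) = -B y (A ξ x) := fun x y ↦ by
      rw [h.symm, hA.skew_right, h.symm]
    have hswap : P = ∑ j, ∑ k, B (A (b' j) (b' k)) (A ξ (A (b j) (b k))) := by
      have h1 : ∀ x y, ∑ k, B (A x (b k)) (A ξ (A y (b' k))) =
          ∑ k, B (A x (b' k)) (A ξ (A y (b k))) := fun x y ↦
        h.sum_dual_swap b hb' (B.compl₁₂ (A x) (A ξ ∘ₗ A y))
      have h2 : ∀ k, ∑ j, B (A (b j) (b' k)) (A ξ (A (b' j) (b k))) =
          ∑ j, B (A (b' j) (b' k)) (A ξ (A (b j) (b k))) := fun k ↦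
        h.sum_dual_swap b hb' (B.compl₁₂ (A.flip (b' k)) (A ξ ∘ₗ A.flip (b k)))
      rw [hP]
      simp only [h1]
      rw [Finset.sum_comm]
      simp only [h2]
      rw [Finset.sum_comm]
    have : P = -P := by
      conv_lhs => rw [hswap]
      simp only [hP, ← Finset.sum_neg_distrib]
      exact Finset.sum_congr rfl fun j _ ↦ Finset.sum_congr rfl fun k _ ↦ hneg _ _
    linarith
  have hS : ∀ (f : V →ₗ[ℝ] ℝ) (x y : V), ∑ i, f (b i) * B (A x y) (b' i) = f (A x y) := by
    intro f x y
    simp only [h.symm (A x y)]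
    exact sum_dual_mul b hb' f _
  have hN0 : N = 0 := by
    -- Contracting `hstar` with the 3-form itself gives `3 P = 6 N`.
    have e1 : ∑ i, ∑ j, ∑ k, (B (A (b i) (b j)) (A ξ (b k)) + B (A (b j) (b k)) (A ξ (b i)) +
          B (A (b k) (b i)) (A ξ (b j))) * B (A (b' i) (b' j)) (b' k) =
        ∑ i, ∑ j, ∑ k, (2 * (B (b i) ξ * B (A ξ (b j)) (b k) + B (b j) ξ * B (A ξ (b k)) (b i) +
          B (b k) ξ * B (A ξ (b i)) (b j))) * B (A (b' i) (b' j)) (b' k) := by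
      simp only [hstar]
    -- The cyclic symmetry of the 3-form makes the three summands on each side of `e1` equal after
    -- contraction.
    have hcyc : ∀ f : V → V → V → ℝ,
        ∑ i, ∑ j, ∑ k, f (b j) (b k) (b i) * B (A (b' i) (b' j)) (b' k) =
          ∑ i, ∑ j, ∑ k, f (b i) (b j) (b k) * B (A (b' i) (b' j)) (b' k) := by
      intro f
      rw [Finset.sum_comm]
      refine Finset.sum_congr rfl fun i _ ↦ ?_
      rw [Finset.sum_comm]
      refine Finset.sum_congr rfl fun j _ ↦ Finset.sum_congr rfl fun k _ ↦ ?_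
      rw [hA.val_cycle (b' k)]
    have a1 : ∑ i, ∑ j, ∑ k, B (A (b i) (b j)) (A ξ (b k)) * B (A (b' i) (b' j)) (b' k) = P := by
      refine Finset.sum_congr rfl fun i _ ↦ Finset.sum_congr rfl fun j _ ↦ ?_
      exact hS (B (A (b i) (b j)) ∘ₗ A ξ) _ _
    have c1 : ∑ i, ∑ j, ∑ k, B (b k) ξ * B (A ξ (b i)) (b j) * B (A (b' i) (b' j)) (b' k) = N := by
      refine Finset.sum_congr rfl fun i _ ↦ Finset.sum_congr rfl fun j _ ↦ ?_
      have := hS (B.flip ξ) (b' i) (b' j)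
      simp only [LinearMap.BilinForm.flip_apply] at this
      rw [hA.val_cycle ξ (b' i) (b' j), ← this, Finset.mul_sum]
      exact Finset.sum_congr rfl fun k _ ↦ by ring
    have a2 := hcyc fun x y z ↦ B (A x y) (A ξ z)
    have a3 := hcyc fun x y z ↦ B (A y z) (A ξ x)
    have c2 := hcyc fun x y z ↦ B z ξ * B (A ξ x) y
    have c3 := hcyc fun x y z ↦ B x ξ * B (A ξ y) z
    simp only [mul_add, add_mul, Finset.sum_add_distrib, mul_assoc, ← Finset.mul_sum] at e1 a1 a2 a3 c1 c2 c3
    linarith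
  -- only the screen part contributes to `N`
  have hξ1 : ∀ x, B (A ξ ξ) x = 0 := hA.val_diag ξ
  have hξ2 : ∀ x, B (A ξ x) ξ = 0 := hA.val_self' ξ
  have hN1 : N = ∑ l, ∑ k, B (A ξ (e k)) (e l) * B (A ξ (e k)) (e l) / B (e k) (e k) /
      B (e l) (e l) := by
    have h1 : ∀ x y, ∑ k, B (A ξ x) (b k) * B (A ξ y) (b' k) =
        ∑ l, B (A ξ x) (e l) * B (A ξ y) (e l) / B (e l) (e l) := fun x y ↦ by
      refine (h.sum_dual b hb'
        ((LinearMap.mul ℝ ℝ).compl₁₂ (B (A ξ x)) (B (A ξ y)))).trans ?_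
      simp [hξ2]
    have h2 : ∀ l, ∑ j, B (A ξ (b j)) (e l) * B (A ξ (b' j)) (e l) =
        ∑ k, B (A ξ (e k)) (e l) * B (A ξ (e k)) (e l) / B (e k) (e k) := fun l ↦ by
      refine (h.sum_dual b hb' ((LinearMap.mul ℝ ℝ).compl₁₂
        (B.flip (e l) ∘ₗ A ξ) (B.flip (e l) ∘ₗ A ξ))).trans ?_
      simp [hξ1]
    rw [hN]
    simp only [h1]
    rw [Finset.sum_comm]
    simp only [← Finset.sum_div, h2]
  have hterm : ∀ k l, 0 ≤ B (A ξ (e k)) (e l) * B (A ξ (e k)) (e l) / B (e k) (e k) /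
      B (e l) (e l) := fun k l ↦
    div_nonneg (div_nonneg (mul_self_nonneg _) (h.pos k).le) (h.pos l).le
  -- `N` is a sum of nonnegative terms, because the null directions have dropped out and the `e k`
  -- are spacelike.
  have he : ∀ k l, B (A ξ (e k)) (e l) = 0 := by
    intro k l
    rw [hN0] at hN1
    have h1 := (Finset.sum_eq_zero_iff_of_nonneg
      fun l _ ↦ Finset.sum_nonneg fun k _ ↦ hterm k l).1 hN1.symm l (Finset.mem_univ l)
    have h2 := (Finset.sum_eq_zero_iff_of_nonneg fun k _ ↦ hterm k l).1 h1 k (Finset.mem_univ k)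
    have h3 := (h.pos k).ne'
    have h4 := (h.pos l).ne'
    simpa [h3, h4] using h2
  rw [h.expand u, h.expand v, hu, hv]
  simp [hξ1, hξ2, he]

end IsSkewProduct

/-! ### Three-forms of norm zero and the Bianchi identity -/

section

variable {V : Type*} [AddCommGroup V] [Module ℝ V] {B : LinearMap.BilinForm ℝ V}
  {A : V →ₗ[ℝ] V →ₗ[ℝ] V} {ξ ζ : V} {ι : Type*} [Fintype ι] {e : ι → V} {κ : Type*} [Fintype κ]

theorem IsNullFrame.sum_dual₂ (h : IsNullFrame B ξ ζ e) (b : Module.Basis κ ℝ V) {b' : κ → V}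
    (hb' : ∀ i v, B (b' i) v = b.coord i v) (φ ψ : V →ₗ[ℝ] V →ₗ[ℝ] ℝ) :
    ∑ i, ∑ j, φ (b i) (b j) * ψ (b' i) (b' j) =
      φ ξ ξ * ψ ζ ζ + φ ζ ξ * ψ ξ ζ + ∑ k, φ (e k) ξ * ψ (e k) ζ / B (e k) (e k) +
      (φ ξ ζ * ψ ζ ξ + φ ζ ζ * ψ ξ ξ + ∑ k, φ (e k) ζ * ψ (e k) ξ / B (e k) (e k)) +
      ∑ l, (φ ξ (e l) * ψ ζ (e l) + φ ζ (e l) * ψ ξ (e l) +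
        ∑ k, φ (e k) (e l) * ψ (e k) (e l) / B (e k) (e k)) / B (e l) (e l) := by
  have h1 : ∀ f g : V →ₗ[ℝ] ℝ, ∑ i, f (b i) * g (b' i) =
      f ξ * g ζ + f ζ * g ξ + ∑ k, f (e k) * g (e k) / B (e k) (e k) := fun f g ↦
    h.sum_dual b hb' ((LinearMap.mul ℝ ℝ).compl₁₂ f g)
  have h2 : ∀ u v, ∑ i, φ (b i) u * ψ (b' i) v =
      φ ξ u * ψ ζ v + φ ζ u * ψ ξ v + ∑ k, φ (e k) u * ψ (e k) v / B (e k) (e k) := fun u v ↦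
    h1 (φ.flip u) (ψ.flip v)
  simp only [h1, Finset.sum_add_distrib, h2]
  rw [Finset.sum_comm]
  simp only [← Finset.sum_div, h2]

namespace IsSkewProduct

/-- The squared norm of a 3-form whose contraction with `ξ` vanishes on `ξ^⊥`. -/
theorem sum_sq_eq (hA : IsSkewProduct B A) (h : IsNullFrame B ξ ζ e)
    (b : Module.Basis κ ℝ V) {b' : κ → V} (hb' : ∀ i v, B (b' i) v = b.coord i v)
    (hω : ∀ u v, B u ξ = 0 → B v ξ = 0 → B (A ξ u) v = 0) :
    ∑ i, ∑ j, ∑ k, B (A (b i) (b j)) (b k) * B (A (b' i) (b' j)) (b' k) =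
      ∑ m, (∑ l, (∑ k, B (A (e k) (e l)) (e m) * B (A (e k) (e l)) (e m) / B (e k) (e k)) /
        B (e l) (e l)) / B (e m) (e m) -
      6 * ∑ k, B (A ξ ζ) (e k) * B (A ξ ζ) (e k) / B (e k) (e k) := by
  have h1 : ∀ f g : V →ₗ[ℝ] ℝ, ∑ i, f (b i) * g (b' i) =
      f ξ * g ζ + f ζ * g ξ + ∑ k, f (e k) * g (e k) / B (e k) (e k) := fun f g ↦
    h.sum_dual b hb' ((LinearMap.mul ℝ ℝ).compl₁₂ f g)
  have h2 := fun x y ↦ h.sum_dual₂ b hb' (A.compr₂ (B.flip x)) (A.compr₂ (B.flip y))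
  simp only [LinearMap.compr₂_apply, LinearMap.BilinForm.flip_apply] at h2
  -- Only two types of components survive: all arguments in the screen, or `ξ`, `ζ` and one `e k`.
  -- The latter type occurs in six orders. The dual basis exchanges `ξ` and `ζ`, so each order
  -- contributes minus a square; this explains the `-6`.
  have r1 : ∀ k l, B (A ξ (e k)) (e l) = 0 := fun k l ↦ hω _ _ (h.ortho_left k) (h.ortho_left l)
  have r2 : ∀ k l, B (A (e k) ξ) (e l) = 0 := fun k l ↦ by rw [hA.val_skew, r1, neg_zero]
  have r3 : ∀ k l, B (A (e k) (e l)) ξ = 0 := fun k l ↦ by rw [← hA.val_cycle, r1]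
  have r4 : ∀ k, B (A ζ ξ) (e k) = -B (A ξ ζ) (e k) := fun k ↦ hA.val_skew _ _ _
  have r5 : ∀ k, B (A ξ (e k)) ζ = -B (A ξ ζ) (e k) := fun k ↦ hA.skew_right _ _ _
  have r6 : ∀ k, B (A (e k) ξ) ζ = B (A ξ ζ) (e k) := fun k ↦ hA.val_cycle _ _ _
  have r7 : ∀ k, B (A ζ (e k)) ξ = B (A ξ ζ) (e k) := fun k ↦ (hA.val_cycle _ _ _).symm
  have r8 : ∀ k, B (A (e k) ζ) ξ = -B (A ξ ζ) (e k) := fun k ↦ by rw [hA.val_skew, r7]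
  simp only [h1, Finset.sum_add_distrib, h2]
  have h3 : ∀ f : κ → κ → ι → ℝ, ∑ i, ∑ j, ∑ k, f i j k = ∑ k, ∑ i, ∑ j, f i j k := fun f ↦ by
    rw [Finset.sum_comm]
    rw [Finset.sum_congr rfl fun j _ ↦ Finset.sum_comm, Finset.sum_comm]
    exact Finset.sum_congr rfl fun k _ ↦ Finset.sum_comm
  rw [h3]
  simp only [← Finset.sum_div, h2, r1, r2, r3, r4, r5, r6, r7, r8, hA.val_diag, hA.val_self,
    hA.val_self', mul_zero, zero_mul, zero_div, Finset.sum_const_zero, add_zero, zero_add,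
    add_div, Finset.sum_add_distrib, mul_neg, neg_mul, neg_div, Finset.sum_neg_distrib]
  ring

/-- The algebraic consequences of the first Bianchi identity for a metric connection with parallel
torsion `(u ∧ v) ξ + A u v`: if the 3-form given by `A` has norm zero then it is of the form
`ξ ∧ β` with `β ξ = 0`. -/
theorem eq_zero_of_curvature (hA : IsSkewProduct B A) (h : IsNullFrame B ξ ζ e)
    (b : Module.Basis κ ℝ V) {b' : κ → V} (hb' : ∀ i v, B (b' i) v = b.coord i v)
    (hnorm : ∑ i, ∑ j, ∑ k, B (A (b i) (b j)) (b k) * B (A (b' i) (b' j)) (b' k) = 0)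
    (T : V → V → V) (hT : ∀ u v, T u v = B u ξ • v - B v ξ • u + A u v)
    (R : V → V → V → V) (hR₁ : ∀ u v w, R u v w = -R v u w)
    (hR₂ : ∀ u v w z, B (R u v w) z = -B (R u v z) w)
    (hR₃ : ∀ u v w, B (R u v w) ξ = 0)
    (hR₄ : ∀ x y u v w,
      B (A (R x y u) v) w + B (A u (R x y v)) w + B (A u v) (R x y w) = 0)
    (hBianchi : ∀ u v w, R u v w + R v w u + R w u v = T (T u v) w + T (T v w) u + T (T w u) v) :
    (∀ u, A ξ u = 0) ∧
      ∀ u v w, B u ξ = 0 → B v ξ = 0 → B w ξ = 0 → B (A u v) w = 0 := by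
  have hzero : ∀ u, (∀ v, B u v = 0) → u = 0 := fun u hu ↦ by
    rw [h.expand u]; simp [hu]
  have hAA : ∀ u v w z, B (A (A u v) w) z = B (A u v) (A w z) := fun u v w z ↦ by
    rw [hA.val_cycle, h.symm]
  -- The terms of `T(T(u, v), w)` that are quadratic in `B · ξ` cancel in the cyclic sum.
  have hB4 : ∀ u v w z, B (R u v w) z + B (R v w u) z + B (R w u v) z =
      (B (A u v) ξ * B w z + B w ξ * B (A u v) z + B (A u v) (A w z)) +
      (B (A v w) ξ * B u z + B u ξ * B (A v w) z + B (A v w) (A u z)) +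
      (B (A w u) ξ * B v z + B v ξ * B (A w u) z + B (A w u) (A v z)) := by
    intro u v w z
    have := congrArg (fun x ↦ B x z) (hBianchi u v w)
    simp only [hT, map_add, map_sub, map_smul, LinearMap.add_apply, LinearMap.sub_apply,
      LinearMap.smul_apply, smul_eq_mul, hAA] at this
    rw [this, hA.val_skew w v, hA.val_skew u w, hA.val_skew v u]
    ring
  -- Bianchi paired with `ξ`: the curvature side is zero because `R` takes values orthogonal to `ξ`.
  have hstar : ∀ u v w, B (A u v) (A ξ w) + B (A v w) (A ξ u) + B (A w u) (A ξ v) =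
      2 * (B u ξ * B (A ξ v) w + B v ξ * B (A ξ w) u + B w ξ * B (A ξ u) v) := by
    intro u v w
    have h1 := hB4 u v w ξ
    simp only [hR₃] at h1
    have h2 : ∀ x y, B x (A y ξ) = -B x (A ξ y) := fun x y ↦ by rw [hA.skew]; simp
    rw [h2, h2, h2, ← hA.val_cycle ξ u v, ← hA.val_cycle ξ v w, ← hA.val_cycle ξ w u] at h1
    linarith
  have hω : ∀ u v, B u ξ = 0 → B v ξ = 0 → B (A ξ u) v = 0 := fun u v hu hv ↦
    hA.contraction_eq_zero h b hb' hstar hu hv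
  have hsq := hA.sum_sq_eq h b hb' hω
  rw [hnorm] at hsq
  -- the vector `a` with `ω = a ∧ ξ`
  set a := A ζ ξ with ha
  have haξ : B a ξ = 0 := hA.val_self _ _
  have haζ : B a ζ = 0 := hA.val_self' _ _
  have hωζ : ∀ u, B (A ξ u) ζ = B a u := fun u ↦ (hA.val_cycle ζ ξ u).symm
  have hζω : ∀ u, B (A ξ ζ) u = -B a u := fun u ↦ hA.val_skew _ _ _
  have hAξ : ∀ u, B u ξ = 0 → A ξ u = B a u • ξ := by
    intro u hu
    refine sub_eq_zero.1 (hzero _ fun v ↦ ?_)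
    have e1 : B (A ξ u) v = B v ξ * B a u := by
      rw [h.expand v]
      simp only [map_add, map_smul, map_sum, smul_eq_mul, hωζ, hω u _ hu (h.ortho_left _),
        hA.val_self', mul_zero, Finset.sum_const_zero, h.null_left, h.symm ζ ξ, h.pairing,
        LinearMap.add_apply, LinearMap.smul_apply, LinearMap.sum_apply, h.ortho_left]
      ring
    simp only [map_sub, map_smul, LinearMap.sub_apply, LinearMap.smul_apply, smul_eq_mul, e1,
      h.symm ξ v]
    ring
  have hAξζ : A ξ ζ = -a := hA.skew _ _
  -- The identity `hstar` at `(ζ, y, z)`: its two terms containing `B a y * B a z` cancel, and only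
  -- `B (A a y) z` remains.
  have hAa : ∀ y z, B y ξ = 0 → B z ξ = 0 → B (A a y) z = 0 := by
    intro y z hy hz
    have h1 := hstar ζ y z
    rw [hAξ z hz, hAξ y hy, hAξζ] at h1
    have e1 : B (A ζ y) ξ = -B a y := by rw [← hA.val_cycle, hζω]
    have e2 : B (A z ζ) ξ = B a z := hA.val_cycle _ _ _
    have e3 : B (A y z) a = B (A a y) z := (hA.val_cycle _ _ _).symm
    have e4 : B ξ z = 0 := by rw [h.symm, hz]
    simp only [map_smul, map_neg, smul_eq_mul, LinearMap.smul_apply, e1, e2, e3, e4, hy, hz] at h1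
    linarith
  -- the curvature in the directions of `a`
  have hRa : ∀ x y z, B z ξ = 0 → B (R x y z) a = 0 := by
    intro x y z hz
    have h1 := hR₄ x y ξ ζ z
    have h2 : R x y ξ = 0 := hzero _ fun v ↦ by rw [hR₂, hR₃, neg_zero]
    rw [h2, hω _ _ (hR₃ _ _ _) hz, hζω, h.symm a] at h1
    simpa using h1
  have hRa' : ∀ x y z, B z ξ = 0 → B (R x y a) z = 0 := fun x y z hz ↦ by
    rw [hR₂, hRa x y z hz, neg_zero]
  have hAperp : ∀ x y, B x ξ = 0 → B y ξ = 0 → B (A x y) ξ = 0 := fun x y hx hy ↦ by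
    rw [← hA.val_cycle, hω x y hx hy]
  -- By Bianchi this expression is symmetric in `x, y`, and by metricity it is skew in `y, w`; a
  -- trilinear-type expression with both symmetries is zero.
  have hRaxy : ∀ x y w, B x ξ = 0 → B y ξ = 0 → B w ξ = 0 → B (R a x y) w = 0 := by
    have hs : ∀ x y w, B x ξ = 0 → B y ξ = 0 → B w ξ = 0 → B (R a x y) w = B (R a y x) w := by
      intro x y w hx hy hw
      have h1 := hB4 x y a w
      have e1 : B (A x y) (A a w) = 0 := by
        rw [h.symm]; exact hAa _ _ hw (hAperp x y hx hy)
      have e2 : B (A y a) (A x w) = 0 := by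
        rw [hA.val_skew, hAa _ _ hy (hAperp x w hx hw), neg_zero]
      have e3 : B (A a x) (A y w) = 0 := hAa _ _ hx (hAperp y w hy hw)
      rw [hRa' _ _ _ hw, hAperp x y hx hy, hAperp y a hy haξ, hAperp a x haξ hx, hx, hy, haξ,
        e1, e2, e3, hR₁ y a x] at h1
      simp only [map_neg, LinearMap.neg_apply] at h1
      linarith
    intro x y w hx hy hw
    have h1 := hs x y w hx hy hw
    have h2 := hR₂ a y x w
    have h3 := hs y w x hy hw hx
    have h4 := hR₂ a w y x
    have h5 := hs w x y hw hx hy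
    have h6 := hR₂ a x w y
    linarith
  -- Two evaluations of `B F y` with `F = R y a ζ`: invariance of the 3-form at `(ζ, y, a)` gives `B
  -- a a * B F y = 0`, and Bianchi for `ζ, y, a` paired with `y` gives `B F y = B a a * B y y`.
  have hF : ∀ y, B y ξ = 0 → B a y = 0 → B a a ^ 2 * B y y = 0 := by
    intro y hy hay
    set F := R y a ζ with hF
    have hFξ : B F ξ = 0 := hR₃ _ _ _
    have hRz : ∀ z, B z ξ = 0 → R y a z = (-B F z) • ξ := by
      intro z hz
      refine sub_eq_zero.1 (hzero _ fun v ↦ ?_)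
      have e0 : ∀ w, B w ξ = 0 → B (R y a z) w = 0 := fun w hw ↦ by
        rw [hR₁]; simp [hRaxy y z w hy hz hw]
      have e1 : B (R y a z) v = B v ξ * B (R y a z) ζ := by
        conv_lhs => rw [h.expand v]
        simp only [map_add, map_smul, map_sum, smul_eq_mul, hR₃, e0 _ (h.ortho_left _)]
        simp
      rw [hR₂ y a z ζ, ← hF] at e1
      simp only [map_sub, map_smul, LinearMap.sub_apply, LinearMap.smul_apply, smul_eq_mul, e1,
        h.symm ξ v]
      ring
    have h1 := hR₄ y a ζ y a
    rw [← hF, hRz y hy, hRz a haξ] at h1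
    have e1 : B (A F y) a = 0 := by rw [hA.val_cycle, hA.val_skew, hAa y F hy hFξ, neg_zero]
    have e2 : B (A ζ y) ξ = 0 := by rw [← hA.val_cycle, hζω, hay, neg_zero]
    have e3 : B (A a ζ) ξ = B a a := hA.val_cycle _ _ _
    have e4 : B (A ζ y) (A a y) = -B (A y a) (A ζ y) := by
      rw [hA.skew a y, h.symm]; simp
    have e5 : A y y = 0 := hzero _ (hA.val_diag y)
    have e6 : B (R a ζ y) y = 0 := by linarith [hR₂ a ζ y y]
    simp only [map_smul, LinearMap.smul_apply, smul_eq_mul, e1, e2, ← ha] at h1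
    have h2 := hB4 ζ y a y
    rw [hRa' _ _ _ hy, ← hF, e6, e2, haξ, e4, hAperp y a hy haξ, hA.val_self' y a, e3, hy, e5,
      map_zero] at h2
    linear_combination -(B a a) * h2 - h1
  have hsqexp : ∀ u, B u ξ = 0 → B u u = ∑ k, B u (e k) * B u (e k) / B (e k) (e k) := by
    intro u hu
    conv_lhs => arg 2; rw [h.expand u]
    simp only [map_add, map_smul, map_sum, smul_eq_mul, hu]
    simp only [mul_zero, zero_mul, zero_add]
    exact Finset.sum_congr rfl fun k _ ↦ by ring
  have hterm : ∀ x k, 0 ≤ x * x / B (e k) (e k) := fun x k ↦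
    div_nonneg (mul_self_nonneg x) (h.pos k).le
  have hsum0 : ∀ u, ∑ k, B u (e k) * B u (e k) / B (e k) (e k) = 0 → ∀ k, B u (e k) = 0 := by
    intro u hu k
    have h1 := (Finset.sum_eq_zero_iff_of_nonneg fun k _ ↦ hterm (B u (e k)) k).1 hu k
      (Finset.mem_univ k)
    have h2 := (h.pos k).ne'
    simpa [h2] using h1
  have hnull : ∀ u, B u ξ = 0 → B u u = 0 → u = B u ζ • ξ := by
    intro u hu huu
    have h1 := hsum0 u ((hsqexp u hu).symm.trans huu)
    conv_lhs => rw [h.expand u]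
    simp [hu, h1]
  -- If `a ≠ 0`, it is spacelike, and `hF` shows that `ξ^⊥` is spanned by `ξ` and `a`. The 3-form
  -- then vanishes on `ξ^⊥`, so that `hsq` reduces to `6 |a|² = 0`.
  have ha0 : a = 0 := by
    by_contra hne
    have haa : B a a ≠ 0 := fun h0 ↦ hne <| by
      rw [hnull a haξ h0, haζ, zero_smul]
    have hσ : ∀ u v w, B u ξ = 0 → B v ξ = 0 → B w ξ = 0 → B (A u v) w = 0 := by
      intro u v w hu hv hw
      set u' := u - (B a u / B a a) • a with hu'
      have h1 : B u' ξ = 0 := by simp [hu', hu, haξ]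
      have h2 : B a u' = 0 := by simp [hu', haa]
      have h3 : B u' u' = 0 := by simpa [haa] using hF u' h1 h2
      have h4 : u = (B u' ζ) • ξ + (B a u / B a a) • a := by
        rw [← hnull u' h1 h3, hu']; abel
      rw [h4]
      simp [hω v w hv hw, hAa v w hv hw]
    simp only [hσ _ _ _ (h.ortho_left _) (h.ortho_left _) (h.ortho_left _), hζω] at hsq
    refine haa ((hsqexp a haξ).trans ?_)
    simp at hsq
    simpa using hsq
  simp only [hζω, ha0, map_zero, LinearMap.zero_apply, neg_zero, mul_zero, zero_div,
    Finset.sum_const_zero, sub_zero] at hsq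
  -- With `a = 0` the norm condition says that a sum of nonnegative terms over the screen is zero.
  have he : ∀ k l m, B (A (e k) (e l)) (e m) = 0 := by
    have t1 : ∀ l m, 0 ≤ ∑ k, B (A (e k) (e l)) (e m) * B (A (e k) (e l)) (e m) /
        B (e k) (e k) := fun l m ↦ Finset.sum_nonneg fun k _ ↦ hterm _ k
    have t2 : ∀ m, 0 ≤ ∑ l, (∑ k, B (A (e k) (e l)) (e m) * B (A (e k) (e l)) (e m) /
        B (e k) (e k)) / B (e l) (e l) := fun m ↦
      Finset.sum_nonneg fun l _ ↦ div_nonneg (t1 l m) (h.pos l).le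
    intro k l m
    have hk := (h.pos k).ne'
    have hl := (h.pos l).ne'
    have hm := (h.pos m).ne'
    have s1 := (Finset.sum_eq_zero_iff_of_nonneg
      fun m _ ↦ div_nonneg (t2 m) (h.pos m).le).1 hsq.symm m (Finset.mem_univ m)
    have s2 := (Finset.sum_eq_zero_iff_of_nonneg
      fun l _ ↦ div_nonneg (t1 l m) (h.pos l).le).1 ((div_eq_zero_iff.1 s1).resolve_right hm)
      l (Finset.mem_univ l)
    have s3 := (Finset.sum_eq_zero_iff_of_nonneg fun k _ ↦ hterm _ k).1
      ((div_eq_zero_iff.1 s2).resolve_right hl) k (Finset.mem_univ k)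
    simpa [hk] using s3
  have hAξ0 : ∀ u, A ξ u = 0 := by
    have r1 : A ξ ξ = 0 := hzero _ (hA.val_diag ξ)
    have r2 : ∀ k, A ξ (e k) = 0 := fun k ↦ by rw [hAξ _ (h.ortho_left k), ha0]; simp
    intro u
    rw [h.expand u]
    simp [r1, r2, hAξζ, ha0]
  refine ⟨hAξ0, fun u v w hu hv hw ↦ ?_⟩
  have hAξ1 : ∀ u, A u ξ = 0 := fun u ↦ by rw [hA.skew, hAξ0, neg_zero]
  have hAξ2 : ∀ u v, B (A u v) ξ = 0 := fun u v ↦ by rw [← hA.val_cycle, hAξ0]; simp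
  rw [h.expand u, h.expand v, h.expand w, hu, hv, hw]
  simp [hAξ0, hAξ1, hAξ2, he]

end IsSkewProduct
end

/-! ### Three-forms `ξ ∧ β` and the action of the contorsion -/

namespace IsSkewProduct

variable {V : Type*} [AddCommGroup V] [Module ℝ V] {B : LinearMap.BilinForm ℝ V}
  {A : V →ₗ[ℝ] V →ₗ[ℝ] V} {ξ ζ : V}

/-- A 3-form that vanishes on `ξ^⊥` is the wedge product of `ξ` and its contraction with a vector
`ζ` such that `B ξ ζ = 1`. -/
theorem eq_wedge (hA : IsSkewProduct B A) (hζ : B ξ ζ = 1)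
    (hσ : ∀ u v w, B ξ u = 0 → B ξ v = 0 → B ξ w = 0 → B (A u v) w = 0) (u v w : V) :
    B (A u v) w = B ξ u * B (A ζ v) w + B ξ v * B (A ζ w) u + B ξ w * B (A ζ u) v := by
  -- `x - B ξ x • ζ` is the projection to `ξ^⊥` along `ζ`. Expanding the 3-form on three
  -- projections, terms with `ζ` in two slots drop out.
  have hp : ∀ x, B ξ (x - B ξ x • ζ) = 0 := fun x ↦ by simp [hζ]
  have h1 := hσ _ _ _ (hp u) (hp v) (hp w)
  have e1 : B (A u ζ) w = B (A ζ w) u := hA.val_cycle _ _ _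
  have e2 : B (A u v) ζ = B (A ζ u) v := (hA.val_cycle _ _ _).symm
  simp only [map_sub, map_smul, LinearMap.sub_apply, LinearMap.smul_apply, smul_eq_mul,
    hA.val_diag, hA.val_self, hA.val_self', e1, e2] at h1
  linear_combination h1

/-- The action of the contorsion on the 3-form `ξ ∧ β`. -/
theorem contorsion_action (hA : IsSkewProduct B A) (hsymm : ∀ u v, B u v = B v u)
    (hnd : ∀ u, (∀ v, B u v = 0) → u = 0) (hζ : B ξ ζ = 1) (hξ : ∀ u, A ξ u = 0)
    (hσ : ∀ u v w, B ξ u = 0 → B ξ v = 0 → B ξ w = 0 → B (A u v) w = 0)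
    {K : V → V → V} (hK : ∀ v a, K v a = B v a • ξ - B ξ a • v + (1 / 2 : ℝ) • A v a)
    (v a b c : V) :
    B (A (K v a) b) c + B (A a (K v b)) c + B (A a b) (K v c) = -(B ξ v * B (A a b) c) := by
  have hw := hA.eq_wedge hζ hσ
  have hξ1 : ∀ u, A u ξ = 0 := fun u ↦ by rw [hA.skew, hξ, neg_zero]
  have hξ2 : ∀ u v, B ξ (A u v) = 0 := fun u v ↦ by
    rw [hsymm, ← hA.val_cycle, hξ]; simp
  have hξ3 : ∀ u v, B (A u v) ξ = 0 := fun u v ↦ by rw [hsymm, hξ2]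
  -- All terms quadratic in `A` can be written with the symmetric form `q` and the 1-form `B ξ`, and
  -- their cyclic sum cancels by symmetry of `q`. The summand `B v a • ξ` of `K` is killed by `A ξ =
  -- 0`. What is left, from `-B ξ a • v`, is the identity `ξ^♭ ∧ S = 0`.
  set q : V → V → ℝ := fun x y ↦ B (A ζ x) (A ζ y) with hq
  have hqs : ∀ x y, q x y = q y x := fun x y ↦ hsymm _ _
  have hAv : ∀ x y, A x y = B ξ x • A ζ y - B ξ y • A ζ x + B (A ζ x) y • ξ := by
    intro x y
    refine sub_eq_zero.1 (hnd _ fun z ↦ ?_)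
    have h1 := hw x y z
    have h2 : B (A ζ z) x = -B (A ζ x) z := hA.skew_right _ _ _
    simp only [map_sub, map_add, map_smul, LinearMap.sub_apply, LinearMap.add_apply,
      LinearMap.smul_apply, smul_eq_mul]
    rw [h1, h2]
    ring
  have hp : ∀ x y w, B (A ζ w) (A x y) = B ξ x * q w y - B ξ y * q w x := by
    intro x y w
    rw [hAv x y]
    simp only [map_sub, map_add, map_smul, smul_eq_mul, hξ3, hq]
    ring
  have hfull : ∀ x y z w, B (A (A x y) z) w = B ξ z * (B ξ x * q w y - B ξ y * q w x) -
      B ξ w * (B ξ x * q z y - B ξ y * q z x) := by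
    intro x y z w
    rw [hw, hξ2, hp, hA.skew_right ζ (A x y) z, hp]
    ring
  have hK1 : ∀ a b c, B (A (K v a) b) c =
      -(B ξ a * B (A v b) c) + (1 / 2) * B (A (A v a) b) c := by
    intro a b c
    rw [hK]
    simp only [map_sub, map_add, map_smul, LinearMap.sub_apply, LinearMap.add_apply,
      LinearMap.smul_apply, smul_eq_mul, hξ, LinearMap.zero_apply, map_zero]
    ring
  rw [hA.val_cycle a (K v b) c, ← hA.val_cycle (K v c) a b,
    hK1, hK1, hK1, hfull, hfull, hfull, hw v, hw v, hw v, hw a, hqs c a, hqs c b, hqs b a]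
  have e1 := hA.skew_right ζ a v
  have e2 := hA.skew_right ζ b v
  have e3 := hA.skew_right ζ c v
  linear_combination -(B ξ b * B ξ c) * e1 - (B ξ a * B ξ c) * e2 - (B ξ a * B ξ b) * e3

end IsSkewProduct

section

open Filter Topology

/-! ### Constant vector fields on the model space -/

section ConstField

variable (E : Type*) [NormedAddCommGroup E] [NormedSpace ℝ E]

/-- The constant vector field on a normed space. -/
def constField (u : E) (z : E) : TangentSpace 𝓘(ℝ, E) z := u

variable {E}

theorem contMDiffAt_constField (u z : E) :
    ContMDiffAt 𝓘(ℝ, E) (𝓘(ℝ, E).prod 𝓘(ℝ, E)) ∞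
      (fun y ↦ (⟨y, constField E u y⟩ : TangentBundle 𝓘(ℝ, E) E)) z :=
  contMDiffAt_vectorSpace_iff_contDiffAt.2 contDiffAt_const

theorem mlieBracket_constField (u v z : E) :
    VectorField.mlieBracket 𝓘(ℝ, E) (constField E u) (constField E v) z = 0 := by
  have h : VectorField.lieBracket ℝ (fun _ : E ↦ u) (fun _ ↦ v) z = 0 := by
    simp [VectorField.lieBracket]
  rw [← VectorField.mlieBracketWithin_univ, VectorField.mlieBracketWithin_eq_lieBracketWithin]
  exact (congrFun VectorField.lieBracketWithin_univ z).trans h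

end ConstField

variable {n : ℕ} {M : Type*} [TopologicalSpace M]
  [ChartedSpace (EuclideanSpace ℝ (Fin n)) M] [IsManifold (𝓡 n) ∞ M]

/-! ### Coordinate vector fields -/

/-- The vector field with constant coordinates `u` in the chart at `p`. -/
def coordField (p : M) (u : EuclideanSpace ℝ (Fin n)) : ∀ y : M, TangentSpace (𝓡 n) y :=
  VectorField.mpullback (𝓡 n) 𝓘(ℝ, EuclideanSpace ℝ (Fin n)) (extChartAt (𝓡 n) p) (constField _ u)

/-- The isomorphism of the model space with the tangent space at `y` given by the chart at `p`. -/
def coordMap (p y : M) : EuclideanSpace ℝ (Fin n) →L[ℝ] TangentSpace (𝓡 n) y :=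
  (mfderiv (𝓡 n) 𝓘(ℝ, EuclideanSpace ℝ (Fin n)) (extChartAt (𝓡 n) p) y).inverse

theorem coordField_apply (p : M) (u : EuclideanSpace ℝ (Fin n)) (y : M) :
    coordField p u y = coordMap p y u := rfl

theorem isSmoothFieldAt_coordField {p y : M} (hy : y ∈ (extChartAt (𝓡 n) p).source)
    (u : EuclideanSpace ℝ (Fin n)) : IsSmoothFieldAt (coordField p u) y :=
  ContMDiffAt.mpullback_vectorField_preimage (n := ∞) (m := ∞)
    (contMDiffAt_constField u _) (contMDiffAt_extChartAt' (by simpa using hy))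
    (isInvertible_mfderiv_extChartAt hy) (by simp)

theorem IsSmoothFieldAt.isDiffFieldAt {X : ∀ x : M, TangentSpace (𝓡 n) x} {x : M}
    (h : IsSmoothFieldAt X x) : IsDiffFieldAt X x :=
  ContMDiffAt.mdifferentiableAt h (by simp)

/-- The Lie bracket is natural under pullback by the chart, and constant fields commute. -/
theorem mlieBracket_coordField {p y : M} (hy : y ∈ (extChartAt (𝓡 n) p).source)
    (u v : EuclideanSpace ℝ (Fin n)) :
    VectorField.mlieBracket (𝓡 n) (coordField p u) (coordField p v) y = 0 := by
  have : IsManifold (𝓡 n) (minSmoothness ℝ 2) M := by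
    rw [minSmoothness_of_isRCLikeNormedField]
    exact IsManifold.of_le (n := ∞) (by norm_cast)
  have h := VectorField.mpullback_mlieBracket (I := 𝓡 n) (n := ∞) (x₀ := y)
    (f := extChartAt (𝓡 n) p)
    (V := constField _ u) (W := constField _ v)
    ((contMDiffAt_constField u _).mdifferentiableAt (by simp))
    ((contMDiffAt_constField v _).mdifferentiableAt (by simp))
    (contMDiffAt_extChartAt' (by simpa using hy))
    (by rw [minSmoothness_of_isRCLikeNormedField]; norm_cast)
  refine h.symm.trans ?_
  rw [VectorField.mpullback_apply, mlieBracket_constField, map_zero]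

theorem exists_coordField_eq {p y : M} (hy : y ∈ (extChartAt (𝓡 n) p).source)
    (v : TangentSpace (𝓡 n) y) : ∃ u, coordField p u y = v :=
  ⟨mfderiv (𝓡 n) 𝓘(ℝ, EuclideanSpace ℝ (Fin n)) (extChartAt (𝓡 n) p) y v,
    ContinuousLinearMap.IsInvertible.inverse_apply_self (isInvertible_mfderiv_extChartAt hy) v⟩

theorem mvfderiv_coordField {p y : M} (hy : y ∈ (extChartAt (𝓡 n) p).source)
    {f : M → ℝ} (hf : MDifferentiableAt (𝓡 n) 𝓘(ℝ) f y) (u : EuclideanSpace ℝ (Fin n)) :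
    mvfderiv (𝓡 n) f y (coordField p u y) =
      fderiv ℝ (f ∘ (extChartAt (𝓡 n) p).symm) (extChartAt (𝓡 n) p y) u := by
  set φ := extChartAt (𝓡 n) p with hφ
  have hyt : φ y ∈ φ.target := φ.map_source hy
  have hsymm : MDifferentiableAt 𝓘(ℝ, EuclideanSpace ℝ (Fin n)) (𝓡 n) φ.symm (φ y) :=
    (contMDiffOn_extChartAt_symm (n := ∞) p).contMDiffAt
      ((isOpen_extChartAt_target p).mem_nhds hyt) |>.mdifferentiableAt (by simp)
  have hf' : MDifferentiableAt 𝓘(ℝ, EuclideanSpace ℝ (Fin n)) 𝓘(ℝ) (f ∘ φ.symm) (φ y) :=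
    MDifferentiableAt.comp _ (by rwa [φ.left_inv hy]) hsymm
  have hφd : MDifferentiableAt (𝓡 n) 𝓘(ℝ, EuclideanSpace ℝ (Fin n)) φ y :=
    (contMDiffAt_extChartAt' (n := ∞) (by simpa [hφ] using hy)).mdifferentiableAt (by simp)
  have heq : f =ᶠ[𝓝 y] (f ∘ φ.symm) ∘ φ := by
    filter_upwards [(isOpen_extChartAt_source p).mem_nhds hy] with z hz
    simp [φ.left_inv hz]
  have hinv : mfderiv (𝓡 n) 𝓘(ℝ, EuclideanSpace ℝ (Fin n)) φ y (coordField p u y) = u :=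
    (isInvertible_mfderiv_extChartAt (I := 𝓡 n) hy).self_apply_inverse u
  have h1 : mvfderiv (𝓡 n) f y (coordField p u y) =
      mvfderiv (𝓡 n) ((f ∘ φ.symm) ∘ φ) y (coordField p u y) :=
    congrArg (fun L : TangentSpace (𝓡 n) y →L[ℝ] ℝ ↦ L (coordField p u y)) heq.mfderiv_eq
  rw [h1, mvfderiv_comp_apply y hf' hφd, hinv]
  exact congrArg (fun L : EuclideanSpace ℝ (Fin n) →L[ℝ] ℝ ↦ L u) mfderiv_eq_fderiv

end

/-! ### Second derivatives along coordinate fields -/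

section

open Filter Topology

variable {n : ℕ} {M : Type*} [TopologicalSpace M]
  [ChartedSpace (EuclideanSpace ℝ (Fin n)) M] [IsManifold (𝓡 n) ∞ M]

theorem contDiffAt_comp_extChartAt_symm {p y : M} (hy : y ∈ (extChartAt (𝓡 n) p).source)
    {f : M → ℝ} (hf : ContMDiffAt (𝓡 n) 𝓘(ℝ) ∞ f y) :
    ContDiffAt ℝ ∞ (f ∘ (extChartAt (𝓡 n) p).symm) (extChartAt (𝓡 n) p y) := by
  refine ContMDiffAt.contDiffAt (ContMDiffAt.comp _ ?_ ((contMDiffOn_extChartAt_symm (n := ∞) p).contMDiffAt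
    ((isOpen_extChartAt_target p).mem_nhds ((extChartAt (𝓡 n) p).map_source hy))))
  rwa [(extChartAt (𝓡 n) p).left_inv hy]

/-- The coordinate expression of the derivative along a coordinate field. -/
theorem mvfderiv_coordField_eventuallyEq {p y : M} (hy : y ∈ (extChartAt (𝓡 n) p).source)
    {f : M → ℝ} (hf : ContMDiffAt (𝓡 n) 𝓘(ℝ) ∞ f y) (v : EuclideanSpace ℝ (Fin n)) :
    (fun z ↦ mvfderiv (𝓡 n) f z (coordField p v z)) =ᶠ[𝓝 y]
      (fun w ↦ fderiv ℝ (f ∘ (extChartAt (𝓡 n) p).symm) w v) ∘ extChartAt (𝓡 n) p := by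
  have h1 : ∀ᶠ z in 𝓝 y, ContMDiffAt (𝓡 n) 𝓘(ℝ) 1 f z :=
    (contMDiffAt_iff_contMDiffAt_nhds (by simp)).1 (hf.of_le (by norm_cast))
  filter_upwards [h1, (isOpen_extChartAt_source p).mem_nhds hy] with z hz hzp
  exact mvfderiv_coordField hzp (hz.mdifferentiableAt (by simp)) v

theorem contMDiffAt_mvfderiv_coordField {p y : M} (hy : y ∈ (extChartAt (𝓡 n) p).source)
    {f : M → ℝ} (hf : ContMDiffAt (𝓡 n) 𝓘(ℝ) ∞ f y) (v : EuclideanSpace ℝ (Fin n)) :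
    ContMDiffAt (𝓡 n) 𝓘(ℝ) ∞ (fun z ↦ mvfderiv (𝓡 n) f z (coordField p v z)) y := by
  refine ContMDiffAt.congr_of_eventuallyEq ?_ (mvfderiv_coordField_eventuallyEq hy hf v)
  have h2 : ContDiffAt ℝ ∞ (fun w ↦ fderiv ℝ (f ∘ (extChartAt (𝓡 n) p).symm) w v)
      (extChartAt (𝓡 n) p y) :=
    ((contDiffAt_comp_extChartAt_symm hy hf).fderiv_right (m := ∞) (by norm_cast)).clm_apply
      contDiffAt_const
  exact h2.contMDiffAt.comp y (contMDiffAt_extChartAt' (by simpa using hy))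

/-- In the chart both sides are the second Fréchet derivative, which is symmetric. This replaces the
bracket term in all curvature computations. -/
theorem mvfderiv_coordField_comm {p y : M} (hy : y ∈ (extChartAt (𝓡 n) p).source)
    {f : M → ℝ} (hf : ContMDiffAt (𝓡 n) 𝓘(ℝ) ∞ f y) (u v : EuclideanSpace ℝ (Fin n)) :
    mvfderiv (𝓡 n) (fun z ↦ mvfderiv (𝓡 n) f z (coordField p v z)) y (coordField p u y) =
      mvfderiv (𝓡 n) (fun z ↦ mvfderiv (𝓡 n) f z (coordField p u z)) y (coordField p v y) := by
  set φ := extChartAt (𝓡 n) p with hφ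
  have hyt : φ y ∈ φ.target := φ.map_source hy
  have hf' := contDiffAt_comp_extChartAt_symm hy hf
  have key : ∀ a b : EuclideanSpace ℝ (Fin n),
      mvfderiv (𝓡 n) (fun z ↦ mvfderiv (𝓡 n) f z (coordField p b z)) y (coordField p a y) =
        fderiv ℝ (fderiv ℝ (f ∘ φ.symm)) (φ y) a b := by
    intro a b
    rw [mvfderiv_coordField hy
      ((contMDiffAt_mvfderiv_coordField hy hf b).mdifferentiableAt (by simp))]
    have hev : (fun z ↦ mvfderiv (𝓡 n) f z (coordField p b z)) ∘ φ.symm =ᶠ[𝓝 (φ y)]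
        fun w ↦ fderiv ℝ (f ∘ φ.symm) w b := by
      have hc : Tendsto φ.symm (𝓝 (φ y)) (𝓝 y) := by
        have := (continuousAt_extChartAt_symm'' (I := 𝓡 n) hyt).tendsto
        rwa [φ.left_inv hy] at this
      filter_upwards [hc.eventually (mvfderiv_coordField_eventuallyEq hy hf b),
        (isOpen_extChartAt_target p).mem_nhds hyt] with w hw hwt
      simp only [Function.comp_apply] at hw ⊢
      rw [hw, ← hφ, φ.right_inv hwt]
    rw [hev.fderiv_eq]
    rw [fderiv_clm_apply (((hf'.fderiv_right (m := ∞) (by norm_cast))).differentiableAt (by simp))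
      (differentiableAt_const b)]
    simp [hφ]
  rw [key, key]
  exact (hf'.isSymmSndFDerivAt (by rw [minSmoothness_of_isRCLikeNormedField]; norm_cast)) u v

/-! ### Smoothness criteria -/

theorem contMDiffAt_clm_of_apply {F : Type*} [NormedAddCommGroup F] [NormedSpace ℝ F]
    {f : M → EuclideanSpace ℝ (Fin n) →L[ℝ] F} {x : M}
    (h : ∀ v, ContMDiffAt (𝓡 n) 𝓘(ℝ, F) ∞ (fun y ↦ f y v) x) :
    ContMDiffAt (𝓡 n) 𝓘(ℝ, EuclideanSpace ℝ (Fin n) →L[ℝ] F) ∞ f x := by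
  have hf : f = fun y ↦ ∑ i, (ContinuousLinearMap.smulRightL ℝ (EuclideanSpace ℝ (Fin n)) F
      (EuclideanSpace.proj i)) (f y (EuclideanSpace.basisFun (Fin n) ℝ i)) := by
    funext y
    ext v
    conv_lhs => rw [← (EuclideanSpace.basisFun (Fin n) ℝ).sum_repr v]
    simp only [map_sum, map_smul, EuclideanSpace.basisFun_repr]
    simp
  rw [hf]
  refine contMDiffAt_finsetSum fun i _ ↦ ?_
  exact (ContinuousLinearMap.contMDiff (ContinuousLinearMap.smulRightL ℝ
    (EuclideanSpace ℝ (Fin n)) F (EuclideanSpace.proj i))).contMDiffAt.comp x (h _)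

/-- A field of linear maps is smooth if it sends smooth fields to smooth fields. -/
theorem contMDiffAt_hom_of_apply
    {A : ∀ y : M, TangentSpace (𝓡 n) y →L[ℝ] TangentSpace (𝓡 n) y} {x : M}
    (h : ∀ X : ∀ y : M, TangentSpace (𝓡 n) y, IsSmoothFieldAt X x →
      IsSmoothFieldAt (fun y ↦ A y (X y)) x) :
    ContMDiffAt (𝓡 n) ((𝓡 n).prod
      𝓘(ℝ, EuclideanSpace ℝ (Fin n) →L[ℝ] EuclideanSpace ℝ (Fin n))) ∞
      (fun y ↦ Bundle.TotalSpace.mk' (EuclideanSpace ℝ (Fin n) →L[ℝ] EuclideanSpace ℝ (Fin n))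
        (E := fun x : M ↦ TangentSpace (𝓡 n) x →L[ℝ] TangentSpace (𝓡 n) x) y (A y)) x := by
  refine (contMDiffAt_hom_bundle _).2 ⟨contMDiffAt_id, contMDiffAt_clm_of_apply fun v ↦ ?_⟩
  set t := trivializationAt (EuclideanSpace ℝ (Fin n)) (TangentSpace (𝓡 n) : M → Type _) x with ht
  have hx : x ∈ t.baseSet := mem_baseSet_trivializationAt ..
  -- The test fields are those that are constant in the local trivialization; their images are the
  -- columns of the local expression.
  have hX : IsSmoothFieldAt (fun y ↦ t.symmL ℝ y v) x := by
    have := FiberBundle.contMDiffAt_extend (k := ∞) (𝓡 n) (EuclideanSpace ℝ (Fin n)) (x := x) (t.symm x v)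
    have e : (t ⟨x, t.symm x v⟩).2 = v := by rw [t.apply_mk_symm hx]
    simp only [FiberBundle.extend, ← ht, e] at this
    refine ContMDiffAt.congr_of_eventuallyEq this ?_
    filter_upwards [t.open_baseSet.mem_nhds hx] with y hy
    rw [t.symmL_apply hy]
  have := Bundle.contMDiffAt_section x |>.1 (h _ hX)
  refine this.congr_of_eventuallyEq ?_
  filter_upwards [t.open_baseSet.mem_nhds hx] with y hy
  simp [ContinuousLinearMap.inCoordinates, ← ht, Bundle.Trivialization.coe_linearMapAt_of_mem _ hy]

theorem IsSmoothFieldAt.smul {f : M → ℝ} {X : ∀ y : M, TangentSpace (𝓡 n) y} {x : M}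
    (hf : ContMDiffAt (𝓡 n) 𝓘(ℝ) ∞ f x) (hX : IsSmoothFieldAt X x) :
    IsSmoothFieldAt (fun y ↦ f y • X y) x :=
  ContMDiffAt.smul_section hf hX

theorem IsSmoothFieldAt.add {X Y : ∀ y : M, TangentSpace (𝓡 n) y} {x : M}
    (hX : IsSmoothFieldAt X x) (hY : IsSmoothFieldAt Y x) :
    IsSmoothFieldAt (fun y ↦ X y + Y y) x :=
  ContMDiffAt.add_section hX hY

theorem IsSmoothFieldAt.sub {X Y : ∀ y : M, TangentSpace (𝓡 n) y} {x : M}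
    (hX : IsSmoothFieldAt X x) (hY : IsSmoothFieldAt Y x) :
    IsSmoothFieldAt (fun y ↦ X y - Y y) x :=
  ContMDiffAt.sub_section hX hY

theorem IsSmoothFieldAt.val (g : LorentzianMetric n M) {X Y : ∀ y : M, TangentSpace (𝓡 n) y} {x : M}
    (hX : IsSmoothFieldAt X x) (hY : IsSmoothFieldAt Y x) :
    ContMDiffAt (𝓡 n) 𝓘(ℝ) ∞ (fun y ↦ g.val y (X y) (Y y)) x := by
  have : ContMDiffAt (𝓡 n) ((𝓡 n).prod 𝓘(ℝ)) ∞
      (fun y ↦ Bundle.TotalSpace.mk' ℝ (E := Bundle.Trivial M ℝ) y (g.val y (X y) (Y y))) x :=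
    ContMDiffAt.clm_bundle_apply₂ (F₁ := EuclideanSpace ℝ (Fin n))
      (F₂ := EuclideanSpace ℝ (Fin n)) g.contMDiff.contMDiffAt hX hY
  exact (Bundle.contMDiffAt_totalSpace.1 this).2

theorem IsDiffFieldAt.val (g : LorentzianMetric n M) {X Y : ∀ y : M, TangentSpace (𝓡 n) y} {x : M}
    (hX : IsDiffFieldAt X x) (hY : IsDiffFieldAt Y x) :
    MDifferentiableAt (𝓡 n) 𝓘(ℝ) (fun y ↦ g.val y (X y) (Y y)) x := by
  have : MDifferentiableAt (𝓡 n) ((𝓡 n).prod 𝓘(ℝ))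
      (fun y ↦ Bundle.TotalSpace.mk' ℝ (E := Bundle.Trivial M ℝ) y (g.val y (X y) (Y y))) x :=
    MDifferentiableAt.clm_bundle_apply₂ (F₁ := EuclideanSpace ℝ (Fin n))
      (F₂ := EuclideanSpace ℝ (Fin n)) (g.contMDiff.contMDiffAt.mdifferentiableAt (by simp)) hX hY
  exact ((mdifferentiableAt_totalSpace ..).1 this).2

/-- A vector field is smooth if its inner products with smooth fields are smooth. -/
theorem isSmoothFieldAt_of_val (g : LorentzianMetric n M) {V : ∀ y : M, TangentSpace (𝓡 n) y}
    {x : M} (h : ∀ Z : ∀ y : M, TangentSpace (𝓡 n) y, IsSmoothFieldAt Z x →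
      ContMDiffAt (𝓡 n) 𝓘(ℝ) ∞ (fun y ↦ g.val y (V y) (Z y)) x) : IsSmoothFieldAt V x := by
  have hx : x ∈ (extChartAt (𝓡 n) x).source := mem_extChartAt_source x
  set b : Fin n → ∀ y : M, TangentSpace (𝓡 n) y :=
    fun i ↦ coordField x (EuclideanSpace.basisFun (Fin n) ℝ i) with hb
  have hbs : ∀ i, IsSmoothFieldAt (b i) x := fun i ↦ isSmoothFieldAt_coordField hx _
  -- The Gram matrix of the coordinate frame. The components of `V` solve a linear system with this
  -- matrix, so Cramer's rule presents them as smooth functions.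
  set G : M → Matrix (Fin n) (Fin n) ℝ := fun y ↦ .of fun i j ↦ g.val y (b i y) (b j y) with hG
  set l : M → Fin n → ℝ := fun y i ↦ g.val y (V y) (b i y) with hl
  have hsum : ∀ y, ∀ s : Fin n → ℝ, ∑ j, s j • b j y =
      coordMap x y (WithLp.toLp 2 s) := by
    intro y s
    conv_rhs => rw [← (EuclideanSpace.basisFun (Fin n) ℝ).sum_repr (WithLp.toLp 2 s)]
    simp only [map_sum, map_smul, EuclideanSpace.basisFun_repr]
    rfl
  have hdet : ∀ y ∈ (extChartAt (𝓡 n) x).source, (G y).det ≠ 0 := by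
    intro y hy h0
    obtain ⟨s, hs, hs0⟩ := Matrix.exists_mulVec_eq_zero_iff.2 h0
    have hperp : ∀ i, g.val y (∑ j, s j • b j y) (b i y) = 0 := by
      intro i
      have := congrFun hs0 i
      simp only [Matrix.mulVec, dotProduct, hG, Matrix.of_apply, Pi.zero_apply] at this
      rw [← this]
      simp [mul_comm, g.symm]
    have hz : coordMap x y (WithLp.toLp 2 s) = 0 := by
      refine g.eq_of_val_eq y fun w ↦ ?_
      obtain ⟨u, rfl⟩ := exists_coordField_eq hy w
      rw [coordField_apply]
      conv_lhs => rw [← (EuclideanSpace.basisFun (Fin n) ℝ).sum_repr u]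
      simp only [map_sum, map_smul, map_zero, zero_apply]
      refine Finset.sum_eq_zero fun i _ ↦ ?_
      rw [← hsum]
      exact smul_eq_zero_of_right _ (hperp i)
    have hinj := (isInvertible_mfderiv_extChartAt (I := 𝓡 n) hy).self_apply_inverse
      (WithLp.toLp 2 s)
    refine hs ?_
    have h00 : WithLp.toLp 2 s = 0 := by
      refine hinj.symm.trans ?_
      refine (congrArg _ hz).trans (map_zero _)
    exact congrArg WithLp.ofLp h00
  have hV : ∀ y ∈ (extChartAt (𝓡 n) x).source,
      V y = ∑ j, ((G y).det⁻¹ * ((G y).adjugate.mulVec (l y)) j) • b j y := by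
    intro y hy
    obtain ⟨u, hu⟩ := exists_coordField_eq hy (V y)
    have hVs : V y = ∑ j, u j • b j y := by
      rw [hsum, ← hu]; rfl
    have hl' : l y = (G y).mulVec (fun j ↦ u j) := by
      funext i
      simp only [hl, hVs, Matrix.mulVec, dotProduct, hG, Matrix.of_apply]
      simp [mul_comm, g.symm y (b i y)]
    rw [hl', Matrix.mulVec_mulVec, Matrix.adjugate_mul, Matrix.smul_mulVec, Matrix.one_mulVec, hVs]
    refine Finset.sum_congr rfl fun j _ ↦ ?_
    congr 1
    simp [hdet y hy]
  have hGs : ∀ i j, ContMDiffAt (𝓡 n) 𝓘(ℝ) ∞ (fun y ↦ G y i j) x := fun i j ↦ (hbs i).val g (hbs j)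
  have hls : ∀ i, ContMDiffAt (𝓡 n) 𝓘(ℝ) ∞ (fun y ↦ l y i) x := fun i ↦ h _ (hbs i)
  have hdets : ∀ K : M → Matrix (Fin n) (Fin n) ℝ,
      (∀ i j, ContMDiffAt (𝓡 n) 𝓘(ℝ) ∞ (fun y ↦ K y i j) x) →
      ContMDiffAt (𝓡 n) 𝓘(ℝ) ∞ (fun y ↦ (K y).det) x := by
    intro K hK
    simp only [Matrix.det_apply']
    refine contMDiffAt_finsetSum fun σ _ ↦ ?_
    exact contMDiffAt_const.mul (contMDiffAt_finsetProd fun i _ ↦ hK _ _)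
  have hVsm : IsSmoothFieldAt
      (fun y ↦ ∑ j, ((G y).det⁻¹ * ((G y).adjugate.mulVec (l y)) j) • b j y) x := by
    refine ContMDiffAt.sum_section (t := fun j y ↦
      ((G y).det⁻¹ * ((G y).adjugate.mulVec (l y)) j) • b j y) fun j _ ↦ ?_
    refine IsSmoothFieldAt.smul ?_ (hbs j)
    refine ContMDiffAt.mul ?_ ?_
    · exact (hdets G hGs).inv₀ (hdet x hx)
    · simp only [Matrix.mulVec, dotProduct]
      refine contMDiffAt_finsetSum fun i _ ↦ ContMDiffAt.mul ?_ (hls i)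
      simp only [Matrix.adjugate_apply]
      refine hdets (fun y ↦ (G y).updateRow i (Pi.single j 1)) fun a c ↦ ?_
      by_cases hai : a = i
      · subst hai
        simpa using contMDiffAt_const
      · simpa [Matrix.updateRow_ne hai] using hGs a c
  refine ContMDiffAt.congr_of_eventuallyEq hVsm ?_
  filter_upwards [(isOpen_extChartAt_source x).mem_nhds hx] with y hy
  rw [← hV y hy]

end

section

open Filter Topology

variable {n : ℕ} {M : Type*} [TopologicalSpace M]
  [ChartedSpace (EuclideanSpace ℝ (Fin n)) M] [IsManifold (𝓡 n) ∞ M]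

/-! ### The vector-valued form of a 3-form -/

namespace LorentzianMetric

theorem bilin_apply (g : LorentzianMetric n M) (x : M) (u v : TangentSpace (𝓡 n) x) :
    g.bilin x u v = g.val x u v := rfl

theorem form_swap_left (x : M) (S : TangentSpace (𝓡 n) x [⋀^Fin 3]→L[ℝ] ℝ)
    (u v w : TangentSpace (𝓡 n) x) : S ![u, v, w] = -S ![v, u, w] := by
  have h := S.toAlternatingMap.map_swap ![v, u, w] (i := 0) (j := 1) (by decide)
  have e : ![v, u, w] ∘ Equiv.swap (0 : Fin 3) 1 = ![u, v, w] := by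
    ext i
    fin_cases i <;> rfl
  rw [e] at h
  exact h

theorem form_swap_right (x : M) (S : TangentSpace (𝓡 n) x [⋀^Fin 3]→L[ℝ] ℝ)
    (u v w : TangentSpace (𝓡 n) x) : S ![u, v, w] = -S ![u, w, v] := by
  have h := S.toAlternatingMap.map_swap ![u, w, v] (i := 1) (j := 2) (by decide)
  have e : ![u, w, v] ∘ Equiv.swap (1 : Fin 3) 2 = ![u, v, w] := by
    ext i
    fin_cases i <;> rfl
  rw [e] at h
  exact h

/-- The bilinear map `(u, v) ↦ S(u, v)`. -/
def formMap (g : LorentzianMetric n M) (x : M) (S : TangentSpace (𝓡 n) x [⋀^Fin 3]→L[ℝ] ℝ) :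
    TangentSpace (𝓡 n) x →ₗ[ℝ] TangentSpace (𝓡 n) x →ₗ[ℝ] TangentSpace (𝓡 n) x :=
  LinearMap.mk₂ ℝ (fun u v ↦ g.formVec x S u v)
    (fun u u' v ↦ g.eq_of_val_eq x fun w ↦ by
      have h := S.vecCons_add ![v, w] u u'
      simpa [val_formVec] using h)
    (fun c u v ↦ g.eq_of_val_eq x fun w ↦ by
      have h := S.vecCons_smul ![v, w] c u
      simpa [val_formVec] using h)
    (fun u v v' ↦ g.eq_of_val_eq x fun w ↦ by
      simpa [val_formVec] using form_add_snd x S u v v' w)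
    (fun c u v ↦ g.eq_of_val_eq x fun w ↦ by
      simpa [val_formVec] using form_smul_snd x S c u v w)

theorem formMap_apply (g : LorentzianMetric n M) (x : M)
    (S : TangentSpace (𝓡 n) x [⋀^Fin 3]→L[ℝ] ℝ) (u v : TangentSpace (𝓡 n) x) :
    g.formMap x S u v = g.formVec x S u v := rfl

theorem bilin_formMap (g : LorentzianMetric n M) (x : M)
    (S : TangentSpace (𝓡 n) x [⋀^Fin 3]→L[ℝ] ℝ) (u v w : TangentSpace (𝓡 n) x) :
    g.bilin x (g.formMap x S u v) w = S ![u, v, w] :=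
  g.val_formVec x S u v w

theorem isSkewProduct_formMap (g : LorentzianMetric n M) (x : M)
    (S : TangentSpace (𝓡 n) x [⋀^Fin 3]→L[ℝ] ℝ) : IsSkewProduct (g.bilin x) (g.formMap x S) where
  skew u v := g.eq_of_val_eq x fun w ↦ by
    simpa [formMap_apply, val_formVec] using form_swap_left x S u v w
  skew_right u v w := by
    rw [bilin_formMap, bilin_formMap]
    exact form_swap_right x S u v w

theorem formNormSq_eq (g : LorentzianMetric n M) (x : M)
    (S : TangentSpace (𝓡 n) x [⋀^Fin 3]→L[ℝ] ℝ) :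
    g.formNormSq x S =
      let b := Module.finBasis ℝ (TangentSpace (𝓡 n) x)
      let b' := fun i ↦ g.sharp x (b.coord i)
      ∑ i, ∑ j, ∑ k, g.bilin x (g.formMap x S (b i) (b j)) (b k) *
        g.bilin x (g.formMap x S (b' i) (b' j)) (b' k) := by
  simp only [bilin_formMap]
  rfl

theorem exists_isNullFrame (g : LorentzianMetric n M) (x : M) {ξ : TangentSpace (𝓡 n) x}
    (hξ : ξ ≠ 0) (hnull : g.val x ξ ξ = 0) :
    ∃ (ζ : TangentSpace (𝓡 n) x) (m : ℕ) (e : Fin m → TangentSpace (𝓡 n) x),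
      IsNullFrame (g.bilin x) ξ ζ e := by
  obtain ⟨b, i₀, hb⟩ := g.lorentzian x
  exact _root_.exists_isNullFrame (g.bilin x) (g.symm x) b i₀ hb hξ hnull

/-- A 3-form of the type `ξ ∧ β` with `β` vanishing on `ξ` is degenerate. -/
theorem formNormSq_eq_zero (g : LorentzianMetric n M) (x : M)
    (S : TangentSpace (𝓡 n) x [⋀^Fin 3]→L[ℝ] ℝ) {ξ : TangentSpace (𝓡 n) x}
    (hξ : ξ ≠ 0) (hnull : g.val x ξ ξ = 0) (hS : ∀ u, g.formMap x S ξ u = 0)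
    (hσ : ∀ u v w, g.val x ξ u = 0 → g.val x ξ v = 0 → g.val x ξ w = 0 → S ![u, v, w] = 0) :
    g.formNormSq x S = 0 := by
  obtain ⟨ζ, m, e, h⟩ := g.exists_isNullFrame x hξ hnull
  have he : ∀ i, g.val x ξ (e i) = 0 := fun i ↦ (g.symm x _ _).trans (h.ortho_left i)
  rw [formNormSq_eq]
  refine ((g.isSkewProduct_formMap x S).sum_sq_eq h _ (fun i v ↦ g.val_sharp x _ v)
    (fun u v _ _ ↦ ?_)).trans ?_
  · rw [hS, map_zero]; rfl
  · simp [bilin_formMap, hS, hσ _ _ _ (he _) (he _) (he _)]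

end LorentzianMetric

theorem exists_isSmoothFieldAt (x : M) (w : TangentSpace (𝓡 n) x) :
    ∃ W : ∀ y : M, TangentSpace (𝓡 n) y, IsSmoothFieldAt W x ∧ W x = w :=
  ⟨FiberBundle.extend _ w, FiberBundle.contMDiffAt_extend (k := ∞) (𝓡 n) _ w, by simp⟩

theorem mvfderiv_mul_sub_mul_add {a b c d s : M → ℝ} {x : M}
    (ha : MDifferentiableAt (𝓡 n) 𝓘(ℝ) a x) (hb : MDifferentiableAt (𝓡 n) 𝓘(ℝ) b x)
    (hc : MDifferentiableAt (𝓡 n) 𝓘(ℝ) c x) (hd : MDifferentiableAt (𝓡 n) 𝓘(ℝ) d x)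
    (hs : MDifferentiableAt (𝓡 n) 𝓘(ℝ) s x) (v : TangentSpace (𝓡 n) x) :
    mvfderiv (𝓡 n) (fun y ↦ a y * b y - c y * d y + s y) x v =
      a x * mvfderiv (𝓡 n) b x v + b x * mvfderiv (𝓡 n) a x v -
        (c x * mvfderiv (𝓡 n) d x v + d x * mvfderiv (𝓡 n) c x v) + mvfderiv (𝓡 n) s x v := by
  have h : mvfderiv (𝓡 n) (a * b - c * d + s) x v =
      a x * mvfderiv (𝓡 n) b x v + b x * mvfderiv (𝓡 n) a x v -
        (c x * mvfderiv (𝓡 n) d x v + d x * mvfderiv (𝓡 n) c x v) + mvfderiv (𝓡 n) s x v := by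
    rw [mvfderiv_add ((ha.mul hb).sub (hc.mul hd)) hs, mvfderiv_sub (ha.mul hb) (hc.mul hd),
      mvfderiv_mul ha hb, mvfderiv_mul hc hd]
    rfl
  exact h

/-! ### The covariant derivative of a twistor-free torsion -/

section Torsion

variable {g : LorentzianMetric n M} {D : AffineConnection n M}
  {ξ : ∀ x : M, TangentSpace (𝓡 n) x} {S : ∀ x : M, TangentSpace (𝓡 n) x [⋀^Fin 3]→L[ℝ] ℝ}

theorem IsSmoothFieldAt.formVec (hS : IsSmoothThreeForm S) {X Y : ∀ y : M, TangentSpace (𝓡 n) y}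
    {x : M} (hX : IsSmoothFieldAt X x) (hY : IsSmoothFieldAt Y x) :
    IsSmoothFieldAt (fun y ↦ g.formVec y (S y) (X y) (Y y)) x := by
  refine isSmoothFieldAt_of_val g fun Z hZ ↦ ?_
  simp only [LorentzianMetric.val_formVec]
  exact hS x X Y Z hX hY hZ

theorem val_torsion
    (hT : ∀ (x : M) (u v : TangentSpace (𝓡 n) x),
      D.torsion x u v = g.val x u (ξ x) • v - g.val x v (ξ x) • u + g.formVec x (S x) u v)
    (x : M) (u v w : TangentSpace (𝓡 n) x) :
    g.val x (D.torsion x u v) w =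
      g.val x u (ξ x) * g.val x v w - g.val x v (ξ x) * g.val x u w + S x ![u, v, w] := by
  simp [hT, LorentzianMetric.val_formVec]

/-- The covariant derivative of a twistor-free torsion in terms of those of its components. -/
theorem val_derivative_torsion (hD : IsMetricConnection g D) (hξ : IsSmoothField ξ)
    (hS : IsSmoothThreeForm S)
    (hT : ∀ (x : M) (u v : TangentSpace (𝓡 n) x),
      D.torsion x u v = g.val x u (ξ x) • v - g.val x v (ξ x) • u + g.formVec x (S x) u v)
    {x : M} {X Y Z : ∀ y : M, TangentSpace (𝓡 n) y} (hX : IsSmoothFieldAt X x)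
    (hY : IsSmoothFieldAt Y x) (hZ : IsSmoothFieldAt Z x) (v : TangentSpace (𝓡 n) x) :
    g.val x (D (fun y ↦ D.torsion y (X y) (Y y)) x v - D.torsion x (D X x v) (Y x) -
        D.torsion x (X x) (D Y x v)) (Z x) =
      g.val x (X x) (D ξ x v) * g.val x (Y x) (Z x) -
        g.val x (Y x) (D ξ x v) * g.val x (X x) (Z x) +
        (mvfderiv (𝓡 n) (fun y ↦ S y ![X y, Y y, Z y]) x v -
          (S x ![D X x v, Y x, Z x] + S x ![X x, D Y x v, Z x] + S x ![X x, Y x, D Z x v])) := by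
  have hTs : IsSmoothFieldAt (fun y ↦ D.torsion y (X y) (Y y)) x := by
    simp only [hT]
    exact ((IsSmoothFieldAt.smul (hX.val g (hξ x)) hY).sub (.smul (hY.val g (hξ x)) hX)).add
      (IsSmoothFieldAt.formVec hS hX hY)
  have h1 := hD x _ Z hTs.isDiffFieldAt hZ.isDiffFieldAt v
  simp only [val_torsion hT] at h1
  have d : ∀ {A B : ∀ y : M, TangentSpace (𝓡 n) y}, IsSmoothFieldAt A x → IsSmoothFieldAt B x →
      MDifferentiableAt (𝓡 n) 𝓘(ℝ) (fun y ↦ g.val y (A y) (B y)) x := fun hA hB ↦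
    hA.isDiffFieldAt.val g hB.isDiffFieldAt
  have dS : MDifferentiableAt (𝓡 n) 𝓘(ℝ) (fun y ↦ S y ![X y, Y y, Z y]) x :=
    (hS x X Y Z hX hY hZ).mdifferentiableAt (by simp)
  rw [mvfderiv_mul_sub_mul_add (d hX (hξ x)) (d hY hZ) (d hY (hξ x)) (d hX hZ) dS] at h1
  have e := fun (A B : ∀ y : M, TangentSpace (𝓡 n) y) (hA : IsSmoothFieldAt A x)
    (hB : IsSmoothFieldAt B x) ↦ hD x A B hA.isDiffFieldAt hB.isDiffFieldAt v
  simp only [e X ξ hX (hξ x), e Y Z hY hZ, e Y ξ hY (hξ x), e X Z hX hZ] at h1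
  simp only [map_sub, sub_apply, val_torsion hT]
  linear_combination -h1

theorem hasParallelTorsion_of_parallel (hD : IsMetricConnection g D) (hξ : IsSmoothField ξ)
    (hS : IsSmoothThreeForm S)
    (hT : ∀ (x : M) (u v : TangentSpace (𝓡 n) x),
      D.torsion x u v = g.val x u (ξ x) • v - g.val x v (ξ x) • u + g.formVec x (S x) u v)
    (hξD : IsParallelField D ξ) (hSD : IsParallelThreeForm D S) : HasParallelTorsion D := by
  intro x Y Z hY hZ v
  have key : D (fun y ↦ D.torsion y (Y y) (Z y)) x v - D.torsion x (D Y x v) (Z x) -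
        D.torsion x (Y x) (D Z x v) = 0 := by
    refine g.eq_of_val_eq x fun w ↦ ?_
    obtain ⟨W, hW, rfl⟩ := exists_isSmoothFieldAt x w
    rw [val_derivative_torsion hD hξ hS hT hY hZ hW v, hSD x Y Z W hY hZ hW v, hξD x]
    simp
  rw [sub_sub, sub_eq_zero] at key
  exact key

end Torsion

end

section

open Filter Topology

variable {n : ℕ} {M : Type*} [TopologicalSpace M]
  [ChartedSpace (EuclideanSpace ℝ (Fin n)) M] [IsManifold (𝓡 n) ∞ M]
  {g : LorentzianMetric n M} {D : AffineConnection n M}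
  {ξ : ∀ x : M, TangentSpace (𝓡 n) x} {S : ∀ x : M, TangentSpace (𝓡 n) x [⋀^Fin 3]→L[ℝ] ℝ}

/-! ### The connection with prescribed torsion -/

theorem contorsion_apply (x : M) (v u : TangentSpace (𝓡 n) x) :
    contorsion g ξ S x v u =
      g.val x u v • ξ x - g.val x (ξ x) v • u + (1 / 2 : ℝ) • g.formVec x (S x) u v := rfl

theorem contMDiffCovariantDerivative_torsionConnection
    (hD : CovariantDerivative.ContMDiffCovariantDerivative D ∞) (hξ : IsSmoothField ξ)
    (hS : IsSmoothThreeForm S) :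
    CovariantDerivative.ContMDiffCovariantDerivative (torsionConnection g D ξ S) ∞ := by
  refine ⟨⟨fun {σ} hσ x hx ↦ ?_⟩⟩
  have hσx : IsSmoothFieldAt σ x :=
    ((contMDiffOn_univ.1 hσ) x).of_le le_self_add
  have h1 := (hD.contMDiff.contMDiff hσ).contMDiffAt (x := x) univ_mem
  have h2 := contMDiffAt_hom_of_apply (A := fun y ↦ contorsion g ξ S y (σ y)) (x := x)
    fun X hX ↦ by
      simp only [contorsion_apply]
      exact ((IsSmoothFieldAt.smul (hX.val g hσx) (hξ x)).sub
        (.smul ((hξ x).val g hσx) hX)).add (.smul contMDiffAt_const (.formVec hS hX hσx))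
  exact (ContMDiffAt.add_section h1 h2).contMDiffWithinAt

/-- For fixed `v` the contorsion is a skew endomorphism, which is why adding it preserves metricity.
-/
theorem val_contorsion (x : M) (v y z : TangentSpace (𝓡 n) x) :
    g.val x (contorsion g ξ S x y v) z + g.val x y (contorsion g ξ S x z v) = 0 := by
  rw [g.symm x y]
  simp only [contorsion_apply, map_add, map_sub, map_smul, add_apply, sub_apply, smul_apply,
    LorentzianMetric.val_formVec, smul_eq_mul, LorentzianMetric.form_swap_right x (S x) v z y]
  rw [g.symm x v y, g.symm x v z]
  ring

theorem isMetricConnection_torsionConnection (hD : IsMetricConnection g D) :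
    IsMetricConnection g (torsionConnection g D ξ S) := by
  intro x Y Z hY hZ v
  rw [hD x Y Z hY hZ v]
  change _ = g.val x (D Y x v + contorsion g ξ S x (Y x) v) (Z x) +
    g.val x (Y x) (D Z x v + contorsion g ξ S x (Z x) v)
  have := val_contorsion (g := g) (ξ := ξ) (S := S) x v (Y x) (Z x)
  simp only [map_add, add_apply]
  linarith

theorem torsion_torsionConnection (x : M) (u v : TangentSpace (𝓡 n) x) :
    (torsionConnection g D ξ S).torsion x u v =
      D.torsion x u v + (g.val x u (ξ x) • v - g.val x v (ξ x) • u + g.formVec x (S x) u v) := by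
  obtain ⟨X, hX, rfl⟩ := exists_isSmoothFieldAt x u
  obtain ⟨Y, hY, rfl⟩ := exists_isSmoothFieldAt x v
  rw [CovariantDerivative.torsion_apply _ hX.isDiffFieldAt hY.isDiffFieldAt,
    CovariantDerivative.torsion_apply _ hX.isDiffFieldAt hY.isDiffFieldAt,
    torsionConnection_apply, torsionConnection_apply]
  have h : g.formVec x (S x) (Y x) (X x) = -g.formVec x (S x) (X x) (Y x) :=
    (g.isSkewProduct_formMap x (S x)).skew _ _
  rw [h, g.symm x (Y x) (X x), g.symm x (ξ x), g.symm x (ξ x)]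
  module

/-- The action of the contorsion on the skew-symmetric component of the torsion. -/
theorem form_contorsion (x : M) (hξ : ξ x ≠ 0) (hnull : g.val x (ξ x) (ξ x) = 0)
    (hA : ∀ u, g.formMap x (S x) (ξ x) u = 0)
    (hσ : ∀ u v w, g.val x (ξ x) u = 0 → g.val x (ξ x) v = 0 → g.val x (ξ x) w = 0 →
      S x ![u, v, w] = 0) (v a b c : TangentSpace (𝓡 n) x) :
    S x ![contorsion g ξ S x a v, b, c] + S x ![a, contorsion g ξ S x b v, c] +
      S x ![a, b, contorsion g ξ S x c v] = -(g.val x (ξ x) v * S x ![a, b, c]) := by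
  obtain ⟨ζ, m, e, h⟩ := g.exists_isNullFrame x hξ hnull
  have := (g.isSkewProduct_formMap x (S x)).contorsion_action (g.symm x)
    (g.bilin_nondegenerate x).1 h.pairing hA (fun u v w hu hv hw ↦ by
      rw [g.bilin_formMap]; exact hσ u v w hu hv hw)
    (K := fun v a ↦ contorsion g ξ S x a v) (fun v a ↦ rfl) v a b c
  simpa only [g.bilin_formMap, g.bilin_apply] using this

/-- Nullity and `S(ξ, ·) = 0` leave only one term. This eigenvalue `g(ξ, v)` is the one matched by
differentiating `e^{±φ}`. -/
theorem contorsion_self (x : M) (hnull : g.val x (ξ x) (ξ x) = 0)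
    (hA : ∀ u, g.formMap x (S x) (ξ x) u = 0) (v : TangentSpace (𝓡 n) x) :
    contorsion g ξ S x (ξ x) v = g.val x (ξ x) v • ξ x := by
  have h : g.formVec x (S x) v (ξ x) = 0 := by
    have := (g.isSkewProduct_formMap x (S x)).skew v (ξ x)
    rw [hA, neg_zero] at this
    exact this
  rw [contorsion_apply, h, hnull, g.symm x v]
  simp

/-- The class of `p` in the screen is zero, so the extension `β` vanishes on `p` together with any
vector of `p^⊥`, although `β` may pair `p` nontrivially with other vectors. -/
theorem IsFlatWedge.algebra {p : ∀ x : M, TangentSpace (𝓡 n) x}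
    {η : ∀ x : M, Screen g p x [⋀^Fin 2]→ₗ[ℝ] ℝ}
    {τ : ∀ x : M, TangentSpace (𝓡 n) x [⋀^Fin 3]→L[ℝ] ℝ} (h : IsFlatWedge g p η τ) (x : M)
    (hnull : g.val x (p x) (p x) = 0) :
    (∀ u v, τ x ![p x, u, v] = 0) ∧
    ∀ u v w, g.val x (p x) u = 0 → g.val x (p x) v = 0 → g.val x (p x) w = 0 →
      τ x ![u, v, w] = 0 := by
  obtain ⟨β, hβ, hτ⟩ := h x
  refine ⟨fun u v ↦ ?_, fun u v w hu hv hw ↦ by rw [hτ, hu, hv, hw]; ring⟩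
  have hp : p x ∈ perp g p x := hnull
  -- Up to sign, `τ(p, u, v)` is `β` evaluated on `p` and this combination, which lies in `p^⊥`.
  have hz : g.val x (p x) u • v - g.val x (p x) v • u ∈ perp g p x := by
    change g.val x (p x) (g.val x (p x) u • v - g.val x (p x) v • u) = 0
    simp [mul_comm]
  have h0 : toScreen g p x ⟨p x, hp⟩ = 0 :=
    (Submodule.Quotient.mk_eq_zero _).2 (Submodule.mem_span_singleton_self (p x))
  have h1 := hβ ⟨p x, hp⟩ ⟨_, hz⟩
  rw [h0, (η x).map_coord_zero (i := 0) (by simp)] at h1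
  have h2 : β ![p x, g.val x (p x) u • v - g.val x (p x) v • u] =
      g.val x (p x) u * β ![p x, v] - g.val x (p x) v * β ![p x, u] := by
    have upd : ∀ z : TangentSpace (𝓡 n) x, ∀ y, Function.update ![p x, y] (1 : Fin 2) z = ![p x, z] := by
      intro z y; ext i; fin_cases i <;> simp
    have e1 := β.map_update_sub ![p x, 0] 1 (g.val x (p x) u • v) (g.val x (p x) v • u)
    have e2 := β.map_update_smul ![p x, 0] 1 (g.val x (p x) u) v
    have e3 := β.map_update_smul ![p x, 0] 1 (g.val x (p x) v) u
    simp only [upd] at e1 e2 e3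
    rw [e1, e2, e3]; rfl
  have h3 : β ![v, p x] = -β ![p x, v] := by
    have := β.toAlternatingMap.map_swap ![p x, v] (i := 0) (j := 1) (by decide)
    have e : ![p x, v] ∘ Equiv.swap (0 : Fin 2) 1 = ![v, p x] := by
      ext i; fin_cases i <;> rfl
    rw [e] at this
    exact this
  rw [hτ, hnull, h3]
  linarith

theorem mvfderiv_exp {φ : M → ℝ} {x : M} (hφ : MDifferentiableAt (𝓡 n) 𝓘(ℝ) φ x)
    (v : TangentSpace (𝓡 n) x) :
    mvfderiv (𝓡 n) (fun y ↦ Real.exp (φ y)) x v = Real.exp (φ x) * mvfderiv (𝓡 n) φ x v := by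
  have h1 : MDifferentiableAt 𝓘(ℝ) 𝓘(ℝ) Real.exp (φ x) :=
    Real.differentiableAt_exp.mdifferentiableAt
  have h2 := mvfderiv_comp_apply (I := 𝓘(ℝ)) (I' := 𝓡 n) x h1 hφ v
  refine h2.trans ?_
  have h3 : mfderiv 𝓘(ℝ) 𝓘(ℝ) Real.exp (φ x) = fderiv ℝ Real.exp (φ x) := mfderiv_eq_fderiv
  have h4 : ∀ t : ℝ, fderiv ℝ Real.exp (φ x) t = Real.exp (φ x) * t := by
    intro t
    rw [(Real.hasDerivAt_exp (φ x)).hasFDerivAt.fderiv]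
    simp [mul_comm]
  refine Eq.trans ?_ (h4 _)
  exact congrArg (fun L : ℝ →L[ℝ] ℝ ↦ L (mvfderiv (𝓡 n) φ x v)) h3

theorem AffineConnection.map_smul {f : M → ℝ} {X : ∀ x : M, TangentSpace (𝓡 n) x} {x : M}
    (hf : MDifferentiableAt (𝓡 n) 𝓘(ℝ) f x) (hX : IsDiffFieldAt X x)
    (v : TangentSpace (𝓡 n) x) :
    D (fun y ↦ f y • X y) x v = f x • D X x v + mvfderiv (𝓡 n) f x v • X x := by
  have := D.isCovariantDerivativeOnUniv.leibniz hX hf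
  exact congrArg (fun L : TangentSpace (𝓡 n) x →L[ℝ] TangentSpace (𝓡 n) x ↦ L v) this

theorem IsSmoothThreeForm.smul {f : M → ℝ} (hf : ContMDiff (𝓡 n) 𝓘(ℝ) ∞ f)
    (hS : IsSmoothThreeForm S) : IsSmoothThreeForm fun x ↦ f x • S x := by
  intro x X Y Z hX hY hZ
  exact hf.contMDiffAt.mul (hS x X Y Z hX hY hZ)

/-! ### From the construction data to parallel torsion -/

namespace IsConstructionData

variable {p₀ : ∀ x : M, TangentSpace (𝓡 n) x} {η : ∀ x : M, Screen g p₀ x [⋀^Fin 2]→ₗ[ℝ] ℝ}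
  {τ₀ : ∀ x : M, TangentSpace (𝓡 n) x [⋀^Fin 3]→L[ℝ] ℝ} {φ : M → ℝ}

theorem mvfderiv_potential (h : IsConstructionData g D p₀ η τ₀ φ)
    (x : M) (v : TangentSpace (𝓡 n) x) :
    mvfderiv (𝓡 n) φ x v = Real.exp (-φ x) * g.val x (p₀ x) v := by
  have hφ : MDifferentiableAt (𝓡 n) 𝓘(ℝ) φ x :=
    h.smooth_potential.contMDiffAt.mdifferentiableAt (by simp)
  rw [h.flat_eq, mvfderiv_exp hφ, ← mul_assoc, ← Real.exp_add]
  simp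

theorem mvfderiv_exp_neg (h : IsConstructionData g D p₀ η τ₀ φ)
    (x : M) (v : TangentSpace (𝓡 n) x) :
    mvfderiv (𝓡 n) (fun y ↦ Real.exp (-φ y)) x v =
      -(Real.exp (-φ x) * (Real.exp (-φ x) * g.val x (p₀ x) v)) := by
  have hφ : MDifferentiableAt (𝓡 n) 𝓘(ℝ) φ x :=
    h.smooth_potential.contMDiffAt.mdifferentiableAt (by simp)
  rw [mvfderiv_exp (φ := fun y ↦ -φ y) hφ.neg, mvfderiv_fun_neg, neg_apply, h.mvfderiv_potential]
  ring

theorem torsionConnection_spec (h : IsConstructionData g D p₀ η τ₀ φ)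
    (hξ : ∀ x, ξ x = Real.exp (-φ x) • p₀ x) (hS : ∀ x, S x = Real.exp (-φ x) • τ₀ x) :
    IsMetricWithParallelTwistorFreeTorsion g (torsionConnection g D ξ S) ξ S ∧
      IsIsotropic g ξ ∧ IsDegenerateForm g S := by
  have hφ : ContMDiff (𝓡 n) 𝓘(ℝ) ∞ fun y ↦ Real.exp (-φ y) :=
    Real.contDiff_exp.contMDiff.comp h.smooth_potential.neg
  have hφd : ∀ x, MDifferentiableAt (𝓡 n) 𝓘(ℝ) (fun y ↦ Real.exp (-φ y)) x :=
    fun x ↦ hφ.contMDiffAt.mdifferentiableAt (by simp)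
  have hξs : IsSmoothField ξ := by
    rw [funext hξ]
    exact fun x ↦ .smul hφ.contMDiffAt (h.smooth_field x)
  have hSs : IsSmoothThreeForm S := by
    rw [funext hS]
    exact h.smooth_form.smul hφ
  have hiso : IsIsotropic g ξ := by
    intro x
    rw [hξ]
    refine ⟨smul_ne_zero (Real.exp_ne_zero _) (h.isotropic x).1, ?_⟩
    simp [(h.isotropic x).2]
  have hA : ∀ x u, g.formMap x (S x) (ξ x) u = 0 := by
    intro x u
    refine g.eq_of_val_eq x fun w ↦ ?_
    have h2 := (h.wedge.algebra x (h.isotropic x).2).1 u w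
    rw [← g.bilin_formMap] at h2
    rw [hξ, map_smul, LinearMap.smul_apply, map_smul, smul_apply, g.formMap_apply, g.val_formVec,
      hS]
    rw [g.bilin_formMap] at h2
    simp [h2]
  have hσ : ∀ x u v w, g.val x (ξ x) u = 0 → g.val x (ξ x) v = 0 → g.val x (ξ x) w = 0 →
      S x ![u, v, w] = 0 := by
    intro x u v w hu hv hw
    simp only [hξ, map_smul, smul_apply, smul_eq_mul, mul_eq_zero, Real.exp_ne_zero,
      false_or] at hu hv hw
    rw [hS]
    simp [(h.wedge.algebra x (h.isotropic x).2).2 u v w hu hv hw]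
  have hmet := isMetricConnection_torsionConnection (ξ := ξ) (S := S) h.leviCivita.metric
  have htor : ∀ (x : M) (u v : TangentSpace (𝓡 n) x), (torsionConnection g D ξ S).torsion x u v =
      g.val x u (ξ x) • v - g.val x v (ξ x) • u + g.formVec x (S x) u v := by
    intro x u v
    rw [torsion_torsionConnection, h.leviCivita.torsion_eq_zero]
    simp
  refine ⟨⟨contMDiffCovariantDerivative_torsionConnection h.leviCivita.smooth hξs hSs, hmet, hξs,
    hSs, htor, hasParallelTorsion_of_parallel hmet hξs hSs htor ?_ ?_⟩, hiso, fun x ↦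
    g.formNormSq_eq_zero x (S x) (hiso x).1 (hiso x).2 (hA x) (hσ x)⟩
  -- The derivative of `e^{-φ}` gives `-g(ξ, v) ξ`, and the contorsion gives `+g(ξ, v) ξ`.
  · intro x
    ext1 v
    change D ξ x v + contorsion g ξ S x (ξ x) v = 0
    rw [contorsion_self x (hiso x).2 (hA x), funext hξ,
      AffineConnection.map_smul (hφd x) (h.smooth_field x).isDiffFieldAt, h.parallel_field x,
      h.mvfderiv_exp_neg]
    simp only [map_smul, smul_apply, smul_eq_mul, zero_apply]
    module
  -- The same cancellation for `S`, with the contorsion term supplied by `form_contorsion`.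
  · intro x X Y Z hX hY hZ v
    change _ = S x ![D X x v + contorsion g ξ S x (X x) v, Y x, Z x] +
      S x ![X x, D Y x v + contorsion g ξ S x (Y x) v, Z x] +
      S x ![X x, Y x, D Z x v + contorsion g ξ S x (Z x) v]
    have h1 := form_contorsion x (hiso x).1 (hiso x).2 (hA x) (hσ x) v (X x) (Y x) (Z x)
    have h2 : mvfderiv (𝓡 n) (fun y ↦ S y ![X y, Y y, Z y]) x v =
        Real.exp (-φ x) * mvfderiv (𝓡 n) (fun y ↦ τ₀ y ![X y, Y y, Z y]) x v +
          τ₀ x ![X x, Y x, Z x] * mvfderiv (𝓡 n) (fun y ↦ Real.exp (-φ y)) x v := by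
      simp only [hS]
      change mvfderiv (𝓡 n) (fun y ↦ Real.exp (-φ y) * τ₀ y ![X y, Y y, Z y]) x v = _
      rw [mvfderiv_fun_mul (hφd x)
        ((h.smooth_form x X Y Z hX hY hZ).mdifferentiableAt (by simp))]
      rfl
    have h3 : ∀ a b c, S x ![a, b, c] = Real.exp (-φ x) * τ₀ x ![a, b, c] := by
      intro a b c
      rw [hS]
      rfl
    rw [h2, h.parallel_form x X Y Z hX hY hZ, h.mvfderiv_exp_neg]
    have h4 : g.val x (ξ x) v = Real.exp (-φ x) * g.val x (p₀ x) v := by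
      rw [hξ]; simp
    rw [h4] at h1
    simp only [← g.bilin_formMap x (S x), map_add, LinearMap.add_apply] at h1 ⊢
    simp only [g.bilin_formMap, h3] at h1 ⊢
    linear_combination -h1

end IsConstructionData

end

section

open Filter Topology

variable {n : ℕ} {M : Type*} [TopologicalSpace M]
  [ChartedSpace (EuclideanSpace ℝ (Fin n)) M] [IsManifold (𝓡 n) ∞ M]
  {g : LorentzianMetric n M} {D : AffineConnection n M}
  {ξ : ∀ x : M, TangentSpace (𝓡 n) x} {S : ∀ x : M, TangentSpace (𝓡 n) x [⋀^Fin 3]→L[ℝ] ℝ}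

/-! ### The components of a parallel torsion are parallel -/

/-- A vector `δ` with `δ ∧ v` orthogonal to `v` for all `v` vanishes. -/
theorem IsNullFrame.eq_zero_of_wedge {V : Type*} [AddCommGroup V] [Module ℝ V]
    {B : LinearMap.BilinForm ℝ V} {ξ ζ : V} {ι : Type*} [Fintype ι] {e : ι → V}
    (h : IsNullFrame B ξ ζ e) (hnd : ∀ u, (∀ v, B v u = 0) → u = 0) {δ : V}
    (hδ : ∀ u v, B u δ * B v v = B v δ * B u v) : δ = 0 := by
  have h1 : B ξ δ = 0 := by
    have := hδ ζ ξ
    rw [h.null_left, h.symm ζ ξ, h.pairing] at this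
    linarith
  have h2 : B ζ δ = 0 := by
    have := hδ ξ ζ
    rw [h.null_right, h.pairing] at this
    linarith
  refine hnd δ fun u ↦ ?_
  -- `ξ + ζ` has square norm `2` and is already known to be orthogonal to `δ`.
  have := hδ u (ξ + ζ)
  simp only [map_add, LinearMap.add_apply, h1, h2, h.null_left, h.null_right, h.symm ζ ξ,
    h.pairing] at this
  linarith

namespace IsMetricWithParallelTwistorFreeTorsion

variable (h : IsMetricWithParallelTwistorFreeTorsion g D ξ S)
include h

theorem val_derivative_eq_zero {x : M} {X Y Z : ∀ y : M, TangentSpace (𝓡 n) y}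
    (hX : IsSmoothFieldAt X x) (hY : IsSmoothFieldAt Y x) (hZ : IsSmoothFieldAt Z x)
    (v : TangentSpace (𝓡 n) x) :
    g.val x (X x) (D ξ x v) * g.val x (Y x) (Z x) - g.val x (Y x) (D ξ x v) * g.val x (X x) (Z x) +
        (mvfderiv (𝓡 n) (fun y ↦ S y ![X y, Y y, Z y]) x v -
          (S x ![D X x v, Y x, Z x] + S x ![X x, D Y x v, Z x] + S x ![X x, Y x, D Z x v])) = 0 := by
  rw [← val_derivative_torsion h.metric h.smooth_vectorial h.smooth_skew h.torsion_eq hX hY hZ v,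
    h.parallel x X Y hX hY v]
  simp

/-- Equal arguments `Y, Y` in the last two slots eliminate the skew-symmetric component from `∇T =
0`, leaving a condition on `∇ξ` alone. -/
theorem isParallelField (hiso : IsIsotropic g ξ) : IsParallelField D ξ := by
  intro x
  ext1 v
  obtain ⟨ζ, m, e, hf⟩ := g.exists_isNullFrame x (hiso x).1 (hiso x).2
  refine hf.eq_zero_of_wedge (g.bilin_nondegenerate x).2 fun u w ↦ ?_
  obtain ⟨X, hX, rfl⟩ := exists_isSmoothFieldAt x u
  obtain ⟨Y, hY, rfl⟩ := exists_isSmoothFieldAt x w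
  have h1 := h.val_derivative_eq_zero hX hY hY v
  have hzero : ∀ y (a b : TangentSpace (𝓡 n) y), S y ![a, b, b] = 0 := by
    intro y a b
    have := LorentzianMetric.form_swap_right y (S y) a b b
    linarith
  simp only [hzero] at h1
  rw [LorentzianMetric.form_swap_right x (S x) (X x) (D Y x v), mvfderiv_const] at h1
  simp only [g.bilin_apply]
  simp only [zero_apply] at h1
  linarith

theorem isParallelThreeForm (hiso : IsIsotropic g ξ) : IsParallelThreeForm D S := by
  intro x X Y Z hX hY hZ v
  have h1 := h.val_derivative_eq_zero hX hY hZ v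
  rw [h.isParallelField hiso x] at h1
  simp only [zero_apply, map_zero] at h1
  linarith

end IsMetricWithParallelTwistorFreeTorsion

/-! ### Curvature in coordinate fields -/

/-- A bump function makes the coordinate field global. Global smoothness allows covariant
derivatives to be iterated as fields, and agreement near `p` keeps the brackets zero there. -/
theorem exists_isSmoothField_eventuallyEq [T2Space M] (p : M) (u : TangentSpace (𝓡 n) p) :
    ∃ X : ∀ y : M, TangentSpace (𝓡 n) y, IsSmoothField X ∧ X p = u ∧
      ∃ a, ∀ᶠ y in 𝓝 p, X y = coordField p a y := by
  obtain ⟨a, ha⟩ := exists_coordField_eq (mem_extChartAt_source (I := 𝓡 n) p) u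
  obtain ⟨f⟩ : Nonempty (SmoothBumpFunction (𝓡 n) p) := inferInstance
  have hs : ContMDiffOn (𝓡 n) ((𝓡 n).prod 𝓘(ℝ, EuclideanSpace ℝ (Fin n))) ∞
      (fun y ↦ (⟨y, coordField p a y⟩ : TangentBundle (𝓡 n) M)) (extChartAt (𝓡 n) p).source :=
    fun y hy ↦ (isSmoothFieldAt_coordField hy a).contMDiffWithinAt
  have key := ContMDiffOn.smul_section_of_tsupport (ψ := f) f.contMDiff.contMDiffOn
    (isOpen_extChartAt_source p) f.tsupport_subset_extChartAt_source hs
  have hev : ∀ᶠ y in 𝓝 p, f y • coordField p a y = coordField p a y := by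
    filter_upwards [f.eventuallyEq_one] with y hy
    rw [hy, Pi.one_apply, one_smul]
  exact ⟨fun y ↦ f y • coordField p a y, key, hev.self_of_nhds.trans ha, a, hev⟩

theorem mvfderiv_comm_of_eventuallyEq {p : M} {f : M → ℝ} (hf : ContMDiffAt (𝓡 n) 𝓘(ℝ) ∞ f p)
    {U V : ∀ y : M, TangentSpace (𝓡 n) y} {a b : EuclideanSpace ℝ (Fin n)}
    (hU : ∀ᶠ y in 𝓝 p, U y = coordField p a y) (hV : ∀ᶠ y in 𝓝 p, V y = coordField p b y) :
    mvfderiv (𝓡 n) (fun y ↦ mvfderiv (𝓡 n) f y (V y)) p (U p) =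
      mvfderiv (𝓡 n) (fun y ↦ mvfderiv (𝓡 n) f y (U y)) p (V p) := by
  have e : ∀ {W : ∀ y : M, TangentSpace (𝓡 n) y} {c : EuclideanSpace ℝ (Fin n)},
      (∀ᶠ y in 𝓝 p, W y = coordField p c y) →
      mvfderiv (𝓡 n) (fun y ↦ mvfderiv (𝓡 n) f y (W y)) p =
      mvfderiv (𝓡 n) (fun y ↦ mvfderiv (𝓡 n) f y (coordField p c y)) p := by
    intro W c hW
    have : (fun y ↦ mvfderiv (𝓡 n) f y (W y)) =ᶠ[𝓝 p]
        fun y ↦ mvfderiv (𝓡 n) f y (coordField p c y) := by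
      filter_upwards [hW] with y hy
      rw [hy]
    exact this.mfderiv_eq
  rw [e hU, e hV, hU.self_of_nhds, hV.self_of_nhds]
  exact mvfderiv_coordField_comm (mem_extChartAt_source p) hf a b

theorem IsSmoothField.covariantDerivative
    (hD : CovariantDerivative.ContMDiffCovariantDerivative D ∞)
    {X Y : ∀ y : M, TangentSpace (𝓡 n) y} (hX : IsSmoothField X) (hY : IsSmoothField Y) :
    IsSmoothField fun y ↦ D Y y (X y) := by
  intro x
  have h1 := (hD.contMDiff.contMDiff (σ := Y)
    (contMDiffOn_univ.2 fun y ↦ hY y)).contMDiffAt (x := x) univ_mem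
  exact ContMDiffAt.clm_bundle_apply h1 (hX x)

/-- In coordinate fields the torsion is the antisymmetrized covariant derivative. -/
theorem eventually_torsion_eq {p : M} {U V : ∀ y : M, TangentSpace (𝓡 n) y}
    (hUs : IsSmoothField U) (hVs : IsSmoothField V) {a b : EuclideanSpace ℝ (Fin n)}
    (hU : ∀ᶠ y in 𝓝 p, U y = coordField p a y) (hV : ∀ᶠ y in 𝓝 p, V y = coordField p b y) :
    ∀ᶠ y in 𝓝 p, D V y (U y) = D.torsion y (U y) (V y) + D U y (V y) := by
  filter_upwards [eventually_eventually_nhds.2 hU, eventually_eventually_nhds.2 hV,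
    (isOpen_extChartAt_source (I := 𝓡 n) p).mem_nhds (mem_extChartAt_source p)] with y hUy hVy hy
  rw [CovariantDerivative.torsion_apply _ (hUs y).isDiffFieldAt (hVs y).isDiffFieldAt,
    EventuallyEq.mlieBracket_vectorField_eq hUy hVy, mlieBracket_coordField hy]
  abel

theorem AffineConnection.congr {X Y : ∀ y : M, TangentSpace (𝓡 n) y} {x : M}
    (hX : IsDiffFieldAt X x) (hY : IsDiffFieldAt Y x) (h : ∀ᶠ y in 𝓝 x, X y = Y y) :
    D X x = D Y x :=
  D.isCovariantDerivativeOnUniv.congr_of_eventuallyEq hX hY univ_mem h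

theorem AffineConnection.map_add {X Y : ∀ y : M, TangentSpace (𝓡 n) y} {x : M}
    (hX : IsDiffFieldAt X x) (hY : IsDiffFieldAt Y x) :
    D (fun y ↦ X y + Y y) x = D X x + D Y x :=
  D.isCovariantDerivativeOnUniv.add hX hY

end

section

open Filter Topology

variable {n : ℕ} {M : Type*} [TopologicalSpace M]
  [ChartedSpace (EuclideanSpace ℝ (Fin n)) M] [IsManifold (𝓡 n) ∞ M]
  {g : LorentzianMetric n M} {D : AffineConnection n M}
  {ξ : ∀ x : M, TangentSpace (𝓡 n) x} {S : ∀ x : M, TangentSpace (𝓡 n) x [⋀^Fin 3]→L[ℝ] ℝ}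

/-- The curvature `[D_U, D_V] W`, for commuting vector fields `U` and `V`. -/
def curvatureField (D : AffineConnection n M) (U V W : ∀ y : M, TangentSpace (𝓡 n) y) (x : M) :
    TangentSpace (𝓡 n) x :=
  D (fun y ↦ D W y (V y)) x (U x) - D (fun y ↦ D W y (U y)) x (V x)

/-- Coordinate frames: smooth fields that are coordinate fields near `p`. -/
structure IsCoordFieldAt (p : M) (X : ∀ y : M, TangentSpace (𝓡 n) y) : Prop where
  smooth : IsSmoothField X
  eventually_eq : ∃ a, ∀ᶠ y in 𝓝 p, X y = coordField p a y

theorem exists_isCoordFieldAt [T2Space M] (p : M) (u : TangentSpace (𝓡 n) p) :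
    ∃ X : ∀ y : M, TangentSpace (𝓡 n) y, IsCoordFieldAt p X ∧ X p = u := by
  obtain ⟨X, h1, h2, h3⟩ := exists_isSmoothField_eventuallyEq p u
  exact ⟨X, ⟨h1, h3⟩, h2⟩

theorem IsCoordFieldAt.mvfderiv_comm {p : M} {f : M → ℝ} {U V : ∀ y : M, TangentSpace (𝓡 n) y}
    (hU : IsCoordFieldAt p U) (hV : IsCoordFieldAt p V)
    (hf : ContMDiffAt (𝓡 n) 𝓘(ℝ) ∞ f p) :
    mvfderiv (𝓡 n) (fun y ↦ mvfderiv (𝓡 n) f y (V y)) p (U p) =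
      mvfderiv (𝓡 n) (fun y ↦ mvfderiv (𝓡 n) f y (U y)) p (V p) := by
  obtain ⟨a, ha⟩ := hU.eventually_eq
  obtain ⟨b, hb⟩ := hV.eventually_eq
  exact mvfderiv_comm_of_eventuallyEq hf ha hb

/-- The second derivatives of `g(W, Z)` along `U` and `V` commute; the mixed first-order terms
cancel in the difference. -/
theorem val_curvatureField (hs : CovariantDerivative.ContMDiffCovariantDerivative D ∞)
    (hD : IsMetricConnection g D) {p : M} {U V W Z : ∀ y : M, TangentSpace (𝓡 n) y}
    (hU : IsCoordFieldAt p U) (hV : IsCoordFieldAt p V) (hW : IsSmoothField W)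
    (hZ : IsSmoothField Z) :
    g.val p (curvatureField D U V W p) (Z p) + g.val p (W p) (curvatureField D U V Z p) = 0 := by
  have second : ∀ A B : ∀ y : M, TangentSpace (𝓡 n) y, IsSmoothField A → IsSmoothField B →
      mvfderiv (𝓡 n) (fun y ↦ mvfderiv (𝓡 n) (fun y ↦ g.val y (W y) (Z y)) y (A y)) p (B p) =
        g.val p (D (fun y ↦ D W y (A y)) p (B p)) (Z p) + g.val p (D W p (A p)) (D Z p (B p)) +
        (g.val p (D W p (B p)) (D Z p (A p)) + g.val p (W p) (D (fun y ↦ D Z y (A y)) p (B p))) := by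
    intro A B hA hB
    have hWA := IsSmoothField.covariantDerivative hs hA hW
    have hZA := IsSmoothField.covariantDerivative hs hA hZ
    have e1 : (fun y ↦ mvfderiv (𝓡 n) (fun y ↦ g.val y (W y) (Z y)) y (A y)) =
        fun y ↦ g.val y (D W y (A y)) (Z y) + g.val y (W y) (D Z y (A y)) :=
      funext fun y ↦ hD y W Z (hW y).isDiffFieldAt (hZ y).isDiffFieldAt (A y)
    rw [e1, mvfderiv_fun_add ((hWA p).isDiffFieldAt.val g (hZ p).isDiffFieldAt)
      ((hW p).isDiffFieldAt.val g (hZA p).isDiffFieldAt), add_apply,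
      hD p _ Z (hWA p).isDiffFieldAt (hZ p).isDiffFieldAt,
      hD p W _ (hW p).isDiffFieldAt (hZA p).isDiffFieldAt]
  have h1 := hU.mvfderiv_comm hV ((hW p).val g (hZ p))
  rw [second V U hV.smooth hU.smooth, second U V hU.smooth hV.smooth] at h1
  simp only [curvatureField, map_sub, sub_apply]
  linarith

/-- The same argument for the function `S(X, Y, Z)`, with `∇S = 0` in place of `∇g = 0`. -/
theorem form_curvatureField (g : LorentzianMetric n M)
    (hs : CovariantDerivative.ContMDiffCovariantDerivative D ∞)
    (hS : IsSmoothThreeForm S) (hD : IsParallelThreeForm D S) {p : M}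
    {U V X Y Z : ∀ y : M, TangentSpace (𝓡 n) y}
    (hU : IsCoordFieldAt p U) (hV : IsCoordFieldAt p V) (hX : IsSmoothField X)
    (hY : IsSmoothField Y) (hZ : IsSmoothField Z) :
    S p ![curvatureField D U V X p, Y p, Z p] + S p ![X p, curvatureField D U V Y p, Z p] +
      S p ![X p, Y p, curvatureField D U V Z p] = 0 := by
  have second : ∀ A B : ∀ y : M, TangentSpace (𝓡 n) y, IsSmoothField A → IsSmoothField B →
      mvfderiv (𝓡 n) (fun y ↦ mvfderiv (𝓡 n) (fun y ↦ S y ![X y, Y y, Z y]) y (A y)) p (B p) =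
        S p ![D (fun y ↦ D X y (A y)) p (B p), Y p, Z p] + S p ![D X p (A p), D Y p (B p), Z p] +
          S p ![D X p (A p), Y p, D Z p (B p)] +
        (S p ![D X p (B p), D Y p (A p), Z p] + S p ![X p, D (fun y ↦ D Y y (A y)) p (B p), Z p] +
          S p ![X p, D Y p (A p), D Z p (B p)]) +
        (S p ![D X p (B p), Y p, D Z p (A p)] + S p ![X p, D Y p (B p), D Z p (A p)] +
          S p ![X p, Y p, D (fun y ↦ D Z y (A y)) p (B p)]) := by
    intro A B hA hB
    have hXA := IsSmoothField.covariantDerivative hs hA hX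
    have hYA := IsSmoothField.covariantDerivative hs hA hY
    have hZA := IsSmoothField.covariantDerivative hs hA hZ
    have e1 : (fun y ↦ mvfderiv (𝓡 n) (fun y ↦ S y ![X y, Y y, Z y]) y (A y)) =
        fun y ↦ S y ![D X y (A y), Y y, Z y] + S y ![X y, D Y y (A y), Z y] +
          S y ![X y, Y y, D Z y (A y)] :=
      funext fun y ↦ hD y X Y Z (hX y) (hY y) (hZ y) (A y)
    have d1 : MDifferentiableAt (𝓡 n) 𝓘(ℝ) (fun y ↦ S y ![D X y (A y), Y y, Z y]) p :=
      (hS p _ Y Z (hXA p) (hY p) (hZ p)).mdifferentiableAt (by simp)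
    have d2 : MDifferentiableAt (𝓡 n) 𝓘(ℝ) (fun y ↦ S y ![X y, D Y y (A y), Z y]) p :=
      (hS p X _ Z (hX p) (hYA p) (hZ p)).mdifferentiableAt (by simp)
    have d3 : MDifferentiableAt (𝓡 n) 𝓘(ℝ) (fun y ↦ S y ![X y, Y y, D Z y (A y)]) p :=
      (hS p X Y _ (hX p) (hY p) (hZA p)).mdifferentiableAt (by simp)
    have d12 : MDifferentiableAt (𝓡 n) 𝓘(ℝ) (fun y ↦ S y ![D X y (A y), Y y, Z y] +
        S y ![X y, D Y y (A y), Z y]) p := d1.add d2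
    rw [e1, mvfderiv_fun_add d12 d3, mvfderiv_fun_add d1 d2, add_apply, add_apply,
      hD p _ Y Z (hXA p) (hY p) (hZ p), hD p X _ Z (hX p) (hYA p) (hZ p),
      hD p X Y _ (hX p) (hY p) (hZA p)]
  have h1 := hU.mvfderiv_comm hV (hS p X Y Z (hX p) (hY p) (hZ p))
  rw [second V U hV.smooth hU.smooth, second U V hU.smooth hV.smooth] at h1
  simp only [curvatureField]
  simp only [← g.bilin_formMap p (S p), map_sub, LinearMap.sub_apply] at h1 ⊢
  linarith

/-- The first Bianchi identity for a connection with parallel torsion. -/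
theorem bianchi_curvatureField (hs : CovariantDerivative.ContMDiffCovariantDerivative D ∞)
    (hT : HasParallelTorsion D)
    (hTs : ∀ X Y : ∀ y : M, TangentSpace (𝓡 n) y, IsSmoothField X → IsSmoothField Y →
      IsSmoothField fun y ↦ D.torsion y (X y) (Y y)) {p : M}
    {U V W : ∀ y : M, TangentSpace (𝓡 n) y}
    (hU : IsCoordFieldAt p U) (hV : IsCoordFieldAt p V) (hW : IsCoordFieldAt p W) :
    curvatureField D U V W p + curvatureField D V W U p + curvatureField D W U V p =
      D.torsion p (D.torsion p (U p) (V p)) (W p) + D.torsion p (D.torsion p (V p) (W p)) (U p) +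
        D.torsion p (D.torsion p (W p) (U p)) (V p) := by
  -- Coordinate fields commute, so `D_A B - D_B A = T(A, B)` near `p`; the second claim
  -- differentiates this using `∇T = 0`.
  have swap : ∀ {A B : ∀ y : M, TangentSpace (𝓡 n) y}, IsCoordFieldAt p A → IsCoordFieldAt p B →
      (D B p (A p) = D.torsion p (A p) (B p) + D A p (B p)) ∧ ∀ v : TangentSpace (𝓡 n) p,
      D (fun y ↦ D B y (A y)) p v =
        D.torsion p (D A p v) (B p) + D.torsion p (A p) (D B p v) + D (fun y ↦ D A y (B y)) p v := by
    intro A B hA hB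
    obtain ⟨a, ha⟩ := hA.eventually_eq
    obtain ⟨b, hb⟩ := hB.eventually_eq
    have hev := eventually_torsion_eq (D := D) hA.smooth hB.smooth ha hb
    refine ⟨hev.self_of_nhds, fun v ↦ ?_⟩
    have s1 := hTs A B hA.smooth hB.smooth
    have s2 := IsSmoothField.covariantDerivative hs hB.smooth hA.smooth
    rw [AffineConnection.congr (IsSmoothField.covariantDerivative hs hA.smooth hB.smooth
      p).isDiffFieldAt ((s1 p).add (s2 p)).isDiffFieldAt hev, AffineConnection.map_add
      (s1 p).isDiffFieldAt (s2 p).isDiffFieldAt, add_apply,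
      hT p A B (hA.smooth p) (hB.smooth p) v]
  simp only [curvatureField]
  rw [(swap hV hW).2 (U p), (swap hW hU).2 (V p), (swap hU hV).2 (W p),
    (swap hV hW).1, (swap hW hU).1, (swap hU hV).1]
  simp only [map_add, add_apply]
  -- After the swaps the second derivatives cancel, and the remaining terms `T(D_U V, W)` cancel in
  -- pairs by antisymmetry, leaving the terms `T(T(·,·),·)`.
  rw [D.torsion_antisymm (V p) (D W p (U p)), D.torsion_antisymm (W p) (D U p (V p)),
    D.torsion_antisymm (U p) (D V p (W p))]
  abel

/-- The torsion of a connection with parallel twistor-free torsion, isotropic vectorial component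
`ξ` and degenerate skew-symmetric component `S` satisfies `S = ξ^♭ ∧ β`, `S(ξ, ·) = 0`. -/
theorem IsMetricWithParallelTwistorFreeTorsion.algebra [T2Space M]
    (h : IsMetricWithParallelTwistorFreeTorsion g D ξ S) (hiso : IsIsotropic g ξ)
    (hdeg : IsDegenerateForm g S) (p : M) :
    (∀ u, g.formMap p (S p) (ξ p) u = 0) ∧
    ∀ u v w, g.val p (ξ p) u = 0 → g.val p (ξ p) v = 0 → g.val p (ξ p) w = 0 →
      S p ![u, v, w] = 0 := by
  have hξ := h.isParallelField hiso
  -- The curvature of vectors is defined through arbitrary chosen extensions. Tensoriality is never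
  -- needed: `eq_zero_of_curvature` takes `R` as a bare function satisfying the curvature
  -- identities.
  choose F hF hFp using fun u ↦ exists_isCoordFieldAt (n := n) (M := M) p u
  obtain ⟨ζ, m, e, hf⟩ := g.exists_isNullFrame p (hiso p).1 (hiso p).2
  have hTs : ∀ X Y : ∀ y : M, TangentSpace (𝓡 n) y, IsSmoothField X → IsSmoothField Y →
      IsSmoothField fun y ↦ D.torsion y (X y) (Y y) := by
    intro X Y hX hY x
    simp only [h.torsion_eq]
    exact ((IsSmoothFieldAt.smul ((hX x).val g (h.smooth_vectorial x)) (hY x)).sub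
      (.smul ((hY x).val g (h.smooth_vectorial x)) (hX x))).add
      (IsSmoothFieldAt.formVec h.smooth_skew (hX x) (hY x))
  have key := (g.isSkewProduct_formMap p (S p)).eq_zero_of_curvature hf
    (Module.finBasis ℝ (TangentSpace (𝓡 n) p)) (fun i v ↦ g.val_sharp p _ v)
    ((g.formNormSq_eq p (S p)).symm.trans (hdeg p)) (fun u v ↦ D.torsion p u v)
    (fun u v ↦ h.torsion_eq p u v) (fun u v w ↦ curvatureField D (F u) (F v) (F w) p) ?_ ?_ ?_ ?_ ?_
  · refine ⟨key.1, fun u v w hu hv hw ↦ ?_⟩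
    rw [← g.bilin_formMap]
    exact key.2 u v w ((g.symm p _ _).trans hu) ((g.symm p _ _).trans hv)
      ((g.symm p _ _).trans hw)
  · intro u v w
    simp [curvatureField]
  · intro u v w z
    have := val_curvatureField h.smooth h.metric (hF u) (hF v) (hF w).smooth (hF z).smooth
    rw [hFp, hFp, g.symm p w] at this
    simp only [g.bilin_apply]
    linarith
  · intro u v w
    have := val_curvatureField h.smooth h.metric (hF u) (hF v) (hF w).smooth h.smooth_vectorial
    have h0 : curvatureField D (F u) (F v) ξ p = 0 := by
      have hz : ∀ y, D ξ y = 0 := hξ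
      have hz' : D (fun y ↦ (0 : TangentSpace (𝓡 n) y)) = 0 := D.zero
      simp [curvatureField, hz, hz']
    rw [h0, map_zero, add_zero] at this
    exact this
  · intro x y u v w
    have := form_curvatureField g h.smooth h.smooth_skew (h.isParallelThreeForm hiso)
      (hF x) (hF y) (hF u).smooth (hF v).smooth (hF w).smooth
    rw [hFp, hFp, hFp] at this
    simpa only [g.bilin_formMap] using this
  · intro u v w
    have := bianchi_curvatureField h.smooth h.parallel hTs (hF u) (hF v) (hF w)
    rw [hFp, hFp, hFp] at this
    exact this

end

section

open Filter Topology

/-! ### Closed 1-forms on simply connected spaces -/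

/-- The real numbers with the discrete topology. -/
structure DiscreteReal : Type where
  /-- the underlying real number -/
  toReal : ℝ

instance : TopologicalSpace DiscreteReal := ⊥

instance : DiscreteTopology DiscreteReal := ⟨rfl⟩

/-- The covering space of the germs of local primitives: in the trivialization `i` the fibre
coordinate of a germ is its difference to `f i`. -/
def primitiveCore {M : Type*} [TopologicalSpace M] (s : M → Set M) (hs : ∀ i, IsOpen (s i))
    (hmem : ∀ i, i ∈ s i) (f : M → M → ℝ)
    (hf : ∀ i j, ∀ x ∈ s i ∩ s j, ∀ᶠ y in 𝓝 x, f i y - f j y = f i x - f j x) :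
    FiberBundleCore M M DiscreteReal where
  baseSet := s
  isOpen_baseSet := hs
  indexAt := id
  mem_baseSet_at := hmem
  coordChange i j x c := ⟨c.toReal + (f i x - f j x)⟩
  coordChange_self i x _ v := by
    simp
  continuousOn_coordChange i j := by
    rintro ⟨x, c⟩ ⟨hx, -⟩
    refine ContinuousAt.continuousWithinAt ?_
    refine (continuousAt_const (y := (⟨c.toReal + (f i x - f j x)⟩ : DiscreteReal))).congr ?_
    rw [nhds_prod_eq, nhds_discrete DiscreteReal]
    filter_upwards [prod_mem_prod (hf i j x hx) (mem_pure.2 (Set.mem_singleton c))] with q hq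
    obtain ⟨h1, h2⟩ := hq
    rw [show f i q.1 - f j q.1 = f i x - f j x from h1, show q.2 = c from h2]
  coordChange_comp i j k x _ v := by
    simp only [DiscreteReal.mk.injEq]
    ring

/-- Local functions that differ by locally constant functions can be modified by constants to give
a global function, on a simply connected space. -/
theorem exists_global_primitive {M : Type*} [TopologicalSpace M] [SimplyConnectedSpace M]
    [LocallyPathConnectedSpace M] (s : M → Set M) (hs : ∀ i, IsOpen (s i))
    (hmem : ∀ i, i ∈ s i) (f : M → M → ℝ)
    (hf : ∀ i j, ∀ x ∈ s i ∩ s j, ∀ᶠ y in 𝓝 x, f i y - f j y = f i x - f j x) :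
    ∃ φ : M → ℝ, ∀ x, ∀ᶠ y in 𝓝 x, φ y - φ x = f x y - f x x := by
  let Z := primitiveCore s hs hmem f hf
  have hcov : IsCoveringMap (Bundle.TotalSpace.proj : Bundle.TotalSpace DiscreteReal Z.Fiber → M) :=
    FiberBundle.isCoveringMap
  obtain ⟨a₀⟩ : Nonempty M := inferInstance
  -- Lifting the identity of the simply connected base through the covering gives a global section,
  -- that is, a coherent choice of germs.
  obtain ⟨F, ⟨-, hF⟩, -⟩ := hcov.existsUnique_continuousMap_lifts (ContinuousMap.id M) a₀
    (⟨a₀, (⟨0⟩ : DiscreteReal)⟩ : Bundle.TotalSpace DiscreteReal Z.Fiber) rfl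
  have hF1 : ∀ x, (F x).proj = x := fun x ↦ congrFun hF x
  let c : M → ℝ := fun x ↦ DiscreteReal.toReal (F x).snd
  refine ⟨fun x ↦ c x + f x x, fun x ↦ ?_⟩
  have hcont : ContinuousAt (fun y ↦ (Z.localTriv x (F y)).2) x := by
    have h1 : ContinuousAt (Z.localTriv x) (F x) :=
      (Z.localTriv x).continuousAt ((Z.localTriv x).mem_source.2 (by
        change (F x).proj ∈ s x
        rw [hF1]
        exact hmem x))
    exact continuousAt_snd.comp (h1.comp F.continuous.continuousAt)
  -- The fibre is discrete, so a continuous fibre coordinate is locally constant.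
  have hev : ∀ᶠ y in 𝓝 x, (Z.localTriv x (F y)).2 = (Z.localTriv x (F x)).2 := by
    have := hcont.tendsto
    rw [nhds_discrete DiscreteReal, tendsto_pure] at this
    exact this
  filter_upwards [hev] with y hy
  have e : ∀ z, (Z.localTriv x (F z)).2 = ⟨c z + (f z z - f x z)⟩ := by
    intro z
    change (⟨c z + (f (F z).proj (F z).proj - f x (F z).proj)⟩ : DiscreteReal) = _
    rw [hF1]
  rw [e, e] at hy
  have hy' := congrArg DiscreteReal.toReal hy
  simp only at hy'
  linarith

variable {n : ℕ} {M : Type*} [TopologicalSpace M]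
  [ChartedSpace (EuclideanSpace ℝ (Fin n)) M] [IsManifold (𝓡 n) ∞ M]

theorem eventually_eq_of_mvfderiv_eq_zero {f : M → ℝ} {x : M}
    (h : ∀ᶠ y in 𝓝 x, MDifferentiableAt (𝓡 n) 𝓘(ℝ) f y ∧ mvfderiv (𝓡 n) f y = 0) :
    ∀ᶠ y in 𝓝 x, f y = f x := by
  set ψ := extChartAt (𝓡 n) x with hψ
  have hx : x ∈ ψ.source := mem_extChartAt_source x
  obtain ⟨t, ht, hto, hxt⟩ := eventually_nhds_iff.1 h
  have hxT : ψ x ∈ ψ.target := ψ.map_source hx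
  have hsc : ContinuousOn ψ.symm ψ.target := continuousOn_extChartAt_symm x
  have hU : IsOpen (ψ.target ∩ ψ.symm ⁻¹' t) :=
    hsc.isOpen_inter_preimage (isOpen_extChartAt_target x) hto
  have hdiff : ∀ w ∈ ψ.target ∩ ψ.symm ⁻¹' t, DifferentiableAt ℝ (f ∘ ψ.symm) w := by
    intro w hw
    have h1 := (ht _ hw.2).1
    exact (MDifferentiableAt.comp w h1 ((contMDiffOn_extChartAt_symm (n := ∞) x).contMDiffAt
      ((isOpen_extChartAt_target x).mem_nhds hw.1) |>.mdifferentiableAt (by simp))).differentiableAt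
  have hzero : (ψ.target ∩ ψ.symm ⁻¹' t).EqOn (fderiv ℝ (f ∘ ψ.symm)) 0 := by
    intro w hw
    ext u
    have h1 := mvfderiv_coordField (ψ.map_target hw.1) (ht _ hw.2).1 u
    rw [(ht _ hw.2).2, ← hψ, ψ.right_inv hw.1] at h1
    simpa using h1.symm
  have hopen := hU.isOpen_inter_preimage_of_fderiv_eq_zero
    (fun w hw ↦ (hdiff w hw).differentiableWithinAt) hzero {f x}
  have hmem : ψ x ∈ (ψ.target ∩ ψ.symm ⁻¹' t) ∩ (f ∘ ψ.symm) ⁻¹' {f x} := by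
    refine ⟨⟨hxT, ?_⟩, ?_⟩
    · simpa [ψ.left_inv hx] using hxt
    · simp [ψ.left_inv hx]
  filter_upwards [(continuousAt_extChartAt (I := 𝓡 n) x).preimage_mem_nhds (hopen.mem_nhds hmem),
    (isOpen_extChartAt_source (I := 𝓡 n) x).mem_nhds hx] with y hy hys
  have := hy.2
  simp only [Set.mem_preimage, Function.comp_apply, Set.mem_singleton_iff] at this
  rwa [← hψ, ψ.left_inv hys] at this

/-- A closed 1-form has local primitives. -/
theorem exists_local_primitive (α : ∀ x : M, TangentSpace (𝓡 n) x →L[ℝ] ℝ)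
    (hα : ∀ (x : M) (X : ∀ y : M, TangentSpace (𝓡 n) y), IsSmoothFieldAt X x →
      ContMDiffAt (𝓡 n) 𝓘(ℝ) ∞ (fun y ↦ α y (X y)) x)
    (hclosed : ∀ p : M, ∀ y ∈ (extChartAt (𝓡 n) p).source, ∀ u v : EuclideanSpace ℝ (Fin n),
      mvfderiv (𝓡 n) (fun z ↦ α z (coordField p v z)) y (coordField p u y) =
        mvfderiv (𝓡 n) (fun z ↦ α z (coordField p u z)) y (coordField p v y)) (p : M) :
    ∃ s : Set M, IsOpen s ∧ p ∈ s ∧ ∃ f : M → ℝ, ∀ y ∈ s,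
      ContMDiffAt (𝓡 n) 𝓘(ℝ) ∞ f y ∧ mvfderiv (𝓡 n) f y = α y := by
  set ψ := extChartAt (𝓡 n) p with hψ
  have hp : p ∈ ψ.source := mem_extChartAt_source p
  set θ : EuclideanSpace ℝ (Fin n) → EuclideanSpace ℝ (Fin n) →L[ℝ] ℝ :=
    fun w ↦ (α (ψ.symm w)).comp (coordMap p (ψ.symm w)) with hθ
  have hθs : ∀ w ∈ ψ.target, ContDiffAt ℝ ∞ θ w := by
    intro w hw
    have h1 : ContMDiffAt (𝓡 n) 𝓘(ℝ, EuclideanSpace ℝ (Fin n) →L[ℝ] ℝ) ∞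
        (fun y ↦ ((α y).comp (coordMap p y) : EuclideanSpace ℝ (Fin n) →L[ℝ] ℝ)) (ψ.symm w) :=
      contMDiffAt_clm_of_apply fun v ↦
        hα _ (coordField p v) (isSmoothFieldAt_coordField (ψ.map_target hw) v)
    exact (h1.comp w ((contMDiffOn_extChartAt_symm (n := ∞) p).contMDiffAt
      ((isOpen_extChartAt_target p).mem_nhds hw))).contDiffAt
  have hsym : ∀ w ∈ ψ.target, ∀ u v, fderiv ℝ θ w u v = fderiv ℝ θ w v u := by
    intro w hw
    have e : ∀ a b, fderiv ℝ θ w a b =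
        mvfderiv (𝓡 n) (fun z ↦ α z (coordField p b z)) (ψ.symm w) (coordField p a (ψ.symm w)) := by
      intro a b
      have hsm := hα _ (coordField p b) (isSmoothFieldAt_coordField (ψ.map_target hw) b)
      rw [mvfderiv_coordField (ψ.map_target hw) (hsm.mdifferentiableAt (by simp)), ← hψ,
        ψ.right_inv hw]
      have : (fun z ↦ α z (coordField p b z)) ∘ ψ.symm = fun w ↦ θ w b := rfl
      rw [this, fderiv_clm_apply ((hθs w hw).differentiableAt (by simp)) (differentiableAt_const b)]
      simp
    intro u v
    rw [e, e, hclosed p _ (ψ.map_target hw)]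
  obtain ⟨r, hr, hball⟩ := Metric.isOpen_iff.1 (isOpen_extChartAt_target (I := 𝓡 n) p) (ψ p)
    (ψ.map_source hp)
  -- The Poincaré lemma on a ball in the chart, where closedness is the symmetry of the derivative
  -- of `θ`.
  obtain ⟨F, hF⟩ := (convex_ball (ψ p) r).exists_forall_hasFDerivAt_of_fderiv_symmetric
    Metric.isOpen_ball (fun w hw ↦ ((hθs w (hball hw)).differentiableAt
      (by simp)).differentiableWithinAt) (fun w hw ↦ hsym w (hball hw))
  have hFs : ContDiffOn ℝ ∞ F (Metric.ball (ψ p) r) := by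
    rw [contDiffOn_infty_iff_fderiv_of_isOpen Metric.isOpen_ball]
    refine ⟨fun w hw ↦ (hF w hw).differentiableAt.differentiableWithinAt, ?_⟩
    exact ContDiffOn.congr (fun w hw ↦ (hθs w (hball hw)).contDiffWithinAt)
      fun w hw ↦ (hF w hw).fderiv
  refine ⟨ψ.source ∩ ψ ⁻¹' Metric.ball (ψ p) r, (continuousOn_extChartAt p).isOpen_inter_preimage
    (isOpen_extChartAt_source p) Metric.isOpen_ball, ⟨hp, Metric.mem_ball_self hr⟩, F ∘ ψ,
    fun y hy ↦ ?_⟩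
  have hψy : ContMDiffAt (𝓡 n) 𝓘(ℝ, EuclideanSpace ℝ (Fin n)) ∞ ψ y :=
    contMDiffAt_extChartAt' (by simpa [hψ] using hy.1)
  have hsm : ContMDiffAt (𝓡 n) 𝓘(ℝ) ∞ (F ∘ ψ) y :=
    ContMDiffAt.comp y ((hFs.contDiffAt (Metric.isOpen_ball.mem_nhds hy.2)).contMDiffAt) hψy
  refine ⟨hsm, ?_⟩
  ext v
  obtain ⟨u, rfl⟩ := exists_coordField_eq hy.1 v
  rw [mvfderiv_coordField hy.1 (hsm.mdifferentiableAt (by simp)), ← hψ]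
  have hev : (F ∘ ψ) ∘ ψ.symm =ᶠ[𝓝 (ψ y)] F := by
    filter_upwards [(isOpen_extChartAt_target p).mem_nhds (ψ.map_source hy.1)] with w hw
    simp [ψ.right_inv hw]
  rw [hev.fderiv_eq, (hF _ hy.2).fderiv]
  exact congrArg (fun z ↦ α z (coordField p u z)) (ψ.left_inv hy.1)

/-- A closed 1-form on a simply connected manifold is exact. -/
theorem exists_primitive [SimplyConnectedSpace M] (α : ∀ x : M, TangentSpace (𝓡 n) x →L[ℝ] ℝ)
    (hα : ∀ (x : M) (X : ∀ y : M, TangentSpace (𝓡 n) y), IsSmoothFieldAt X x →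
      ContMDiffAt (𝓡 n) 𝓘(ℝ) ∞ (fun y ↦ α y (X y)) x)
    (hclosed : ∀ p : M, ∀ y ∈ (extChartAt (𝓡 n) p).source, ∀ u v : EuclideanSpace ℝ (Fin n),
      mvfderiv (𝓡 n) (fun z ↦ α z (coordField p v z)) y (coordField p u y) =
        mvfderiv (𝓡 n) (fun z ↦ α z (coordField p u z)) y (coordField p v y)) :
    ∃ φ : M → ℝ, ContMDiff (𝓡 n) 𝓘(ℝ) ∞ φ ∧ ∀ x, mvfderiv (𝓡 n) φ x = α x := by
  have : LocallyPathConnectedSpace M :=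
    ChartedSpace.locallyPathConnectedSpace (EuclideanSpace ℝ (Fin n)) M
  choose s hs hmem f hf using exists_local_primitive α hα hclosed
  -- On overlaps two local primitives differ by a function with zero differential, hence by a
  -- locally constant one.
  obtain ⟨φ, hφ⟩ := exists_global_primitive s hs hmem f fun i j x hx ↦ by
    refine eventually_eq_of_mvfderiv_eq_zero (n := n) (f := fun y ↦ f i y - f j y) ?_
    filter_upwards [((hs i).inter (hs j)).mem_nhds hx] with y hy
    have hi := (hf i y hy.1).1.mdifferentiableAt (by simp)
    have hj := (hf j y hy.2).1.mdifferentiableAt (by simp)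
    refine ⟨hi.sub hj, ?_⟩
    have := mvfderiv_sub hi hj
    rw [(hf i y hy.1).2, (hf j y hy.2).2, sub_self] at this
    exact this
  have hev : ∀ x, φ =ᶠ[𝓝 x] fun y ↦ f x y + (φ x - f x x) := by
    intro x
    filter_upwards [hφ x] with y hy
    linarith
  refine ⟨φ, fun x ↦ ((hf x x (hmem x)).1.add contMDiffAt_const).congr_of_eventuallyEq (hev x),
    fun x ↦ ?_⟩
  have h1 : mvfderiv (𝓡 n) φ x = mvfderiv (𝓡 n) (fun y ↦ f x y + (φ x - f x x)) x :=
    (hev x).mfderiv_eq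
  rw [h1, mvfderiv_fun_add ((hf x x (hmem x)).1.mdifferentiableAt (by simp))
    mdifferentiableAt_const, mvfderiv_const, add_zero, (hf x x (hmem x)).2]

end

/-! ### The potential of `ξ^♭` and the data of the converse -/

section

open Filter Topology

variable {n : ℕ} {M : Type*} [TopologicalSpace M]
  [ChartedSpace (EuclideanSpace ℝ (Fin n)) M] [IsManifold (𝓡 n) ∞ M]
  {g : LorentzianMetric n M} {D C : AffineConnection n M}
  {ξ : ∀ x : M, TangentSpace (𝓡 n) x} {S : ∀ x : M, TangentSpace (𝓡 n) x [⋀^Fin 3]→L[ℝ] ℝ}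

/-- As `ξ` is parallel, `dξ^♭(u, v) = g(ξ, T(u, v))`. The vectorial part of the torsion contributes
a symmetric product minus itself and the skew part contributes `S(ξ, u, v) = 0`, so `ξ^♭` is closed.
-/
theorem IsMetricWithParallelTwistorFreeTorsion.exists_potential [T2Space M]
    [SimplyConnectedSpace M] (h : IsMetricWithParallelTwistorFreeTorsion g C ξ S)
    (hiso : IsIsotropic g ξ) (hdeg : IsDegenerateForm g S) :
    ∃ φ : M → ℝ, ContMDiff (𝓡 n) 𝓘(ℝ) ∞ φ ∧ ∀ x v, mvfderiv (𝓡 n) φ x v = g.val x (ξ x) v := by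
  obtain ⟨φ, h1, h2⟩ := exists_primitive (n := n) (fun x ↦ g.val x (ξ x))
    (fun x X hX ↦ (h.smooth_vectorial x).val g hX) (fun p y hy u v ↦ by
      have hu := isSmoothFieldAt_coordField hy u
      have hv := isSmoothFieldAt_coordField hy v
      have e := fun (X : ∀ z : M, TangentSpace (𝓡 n) z) (hX : IsSmoothFieldAt X y) ↦
        h.metric y ξ X (h.smooth_vectorial y).isDiffFieldAt hX.isDiffFieldAt
      rw [e _ hv, e _ hu, h.isParallelField hiso y]
      have ht := CovariantDerivative.torsion_apply C hu.isDiffFieldAt hv.isDiffFieldAt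
      rw [mlieBracket_coordField hy, sub_zero, h.torsion_eq] at ht
      have h3 : g.val y (ξ y) (g.formVec y (S y) (coordField p u y) (coordField p v y)) = 0 := by
        have h4 := (g.isSkewProduct_formMap y (S y)).val_cycle (ξ y) (coordField p u y)
          (coordField p v y)
        rw [(h.algebra hiso hdeg y).1] at h4
        rw [g.symm]
        exact h4.symm.trans (by simp)
      have h5 := congrArg (g.val y (ξ y)) ht
      simp only [map_add, map_sub, map_smul, smul_eq_mul, h3] at h5
      rw [g.symm y _ (ξ y), g.symm y _ (ξ y)] at h5
      simp only [zero_apply, map_zero]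
      linarith)
  exact ⟨φ, h1, fun x v ↦ by rw [h2]⟩

/-! ### The screen form of a 3-form `p ∧ η` -/

section Screen

/-- The contraction of a 3-form with a vector. -/
def formContract (x : M) (S : TangentSpace (𝓡 n) x [⋀^Fin 3]→L[ℝ] ℝ) (ζ : TangentSpace (𝓡 n) x) :
    TangentSpace (𝓡 n) x [⋀^Fin 2]→L[ℝ] ℝ where
  toMultilinearMap := (S.toAlternatingMap.curryLeft ζ).toMultilinearMap
  cont := S.cont.comp (continuous_const.matrixVecCons continuous_id)
  map_eq_zero_of_eq' := (S.toAlternatingMap.curryLeft ζ).map_eq_zero_of_eq'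

theorem formContract_apply (x : M) (S : TangentSpace (𝓡 n) x [⋀^Fin 3]→L[ℝ] ℝ)
    (ζ u v : TangentSpace (𝓡 n) x) : formContract x S ζ ![u, v] = S ![ζ, u, v] := rfl

variable {p : ∀ x : M, TangentSpace (𝓡 n) x} {τ : ∀ x : M, TangentSpace (𝓡 n) x [⋀^Fin 3]→L[ℝ] ℝ}

/-- The contraction of `τ` with `ζ` vanishes on `p`, so it descends to the quotient. The descent is
realized by a linear section, whose choice changes arguments only by multiples of `p`. -/
theorem exists_screenForm (hτ : ∀ x u v, τ x ![p x, u, v] = 0) (x : M)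
    (ζ : TangentSpace (𝓡 n) x) : ∃ η : Screen g p x [⋀^Fin 2]→ₗ[ℝ] ℝ,
      ∀ Y Z : perp g p x, η ![toScreen g p x Y, toScreen g p x Z] =
        τ x ![ζ, (Y : TangentSpace (𝓡 n) x), (Z : TangentSpace (𝓡 n) x)] := by
  obtain ⟨s, hs⟩ := (toScreen g p x).exists_rightInverse_of_surjective
    (LinearMap.range_eq_top.2 (Submodule.mkQ_surjective _))
  have hs' : ∀ Y : perp g p x, ∃ c : ℝ,
      ((s (toScreen g p x Y) : perp g p x) : TangentSpace (𝓡 n) x) = Y + c • p x := by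
    intro Y
    have h1 : toScreen g p x (s (toScreen g p x Y)) = toScreen g p x Y :=
      LinearMap.congr_fun hs _
    have h2 := (Submodule.Quotient.eq _).1 h1
    obtain ⟨c, hc⟩ := Submodule.mem_span_singleton.1 h2
    refine ⟨c, ?_⟩
    rw [hc]
    simp
  refine ⟨(formContract x (τ x) ζ).toAlternatingMap.compLinearMap ((perp g p x).subtype ∘ₗ s),
    fun Y Z ↦ ?_⟩
  obtain ⟨c, hc⟩ := hs' Y
  obtain ⟨d, hd⟩ := hs' Z
  have h1 : ((formContract x (τ x) ζ).toAlternatingMap.compLinearMap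
      ((perp g p x).subtype ∘ₗ s)) ![toScreen g p x Y, toScreen g p x Z] =
      formContract x (τ x) ζ ![((s (toScreen g p x Y) : perp g p x) : TangentSpace (𝓡 n) x),
        ((s (toScreen g p x Z) : perp g p x) : TangentSpace (𝓡 n) x)] := by
    rw [AlternatingMap.compLinearMap_apply]
    change formContract x (τ x) ζ _ = _
    congr 1
    ext i
    fin_cases i <;> rfl
  rw [h1, formContract_apply, hc, hd]
  have h3 : ∀ a, τ x ![ζ, p x, a] = 0 := fun a ↦ by
    rw [LorentzianMetric.form_swap_left, hτ, neg_zero]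
  have h4 : ∀ a, τ x ![ζ, a, p x] = 0 := fun a ↦ by
    rw [LorentzianMetric.form_swap_right, h3, neg_zero]
  simp only [← g.bilin_formMap, map_add, map_smul, LinearMap.add_apply, LinearMap.smul_apply] at h3 h4 ⊢
  rw [h3, h4, h4]
  simp

/-- The data of a parallel 3-form `p^♭ ∧ η`. -/
theorem exists_screenForm_of_parallel (hD : IsMetricConnection g D) (hp : IsSmoothField p)
    (hiso : IsIsotropic g p) (hpD : IsParallelField D p) (hτs : IsSmoothThreeForm τ)
    (hτD : IsParallelThreeForm D τ) (hτ : ∀ x u v, τ x ![p x, u, v] = 0)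
    (hσ : ∀ x u v w, g.val x (p x) u = 0 → g.val x (p x) v = 0 → g.val x (p x) w = 0 →
      τ x ![u, v, w] = 0) :
    ∃ η : ∀ x : M, Screen g p x [⋀^Fin 2]→ₗ[ℝ] ℝ, IsSmoothScreenForm g p η ∧
      IsParallelScreenForm g D p η ∧ IsFlatWedge g p η τ := by
  choose ζ m e he using fun x ↦ g.exists_isNullFrame x (hiso x).1 (hiso x).2
  choose η hη using fun x ↦ exists_screenForm (g := g) hτ x (ζ x)
  have hwedge : ∀ x u v w, τ x ![u, v, w] = g.val x (p x) u * τ x ![ζ x, v, w] +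
      g.val x (p x) v * τ x ![ζ x, w, u] + g.val x (p x) w * τ x ![ζ x, u, v] := by
    intro x u v w
    have := (g.isSkewProduct_formMap x (τ x)).eq_wedge (he x).pairing
      (fun u v w hu hv hw ↦ by
        rw [g.bilin_formMap]
        exact hσ x u v w hu hv hw) u v w
    simpa only [g.bilin_formMap, g.bilin_apply] using this
  -- The frame vectors `ζ x` are chosen independently at each point, without any continuity. This
  -- formula, valid for every `u`, allows `ζ` to be replaced by a smooth field near a point.
  have hmul : ∀ x u (Y Z : perp g p x), τ x ![u, (Y : TangentSpace (𝓡 n) x), Z] =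
      g.val x (p x) u * η x ![toScreen g p x Y, toScreen g p x Z] := by
    intro x u Y Z
    have hY : g.val x (p x) Y = 0 := Y.2
    have hZ : g.val x (p x) Z = 0 := Z.2
    rw [hη, hwedge x u, hY, hZ]
    ring
  -- `η` is locally the quotient of the smooth functions `τ(U, Y, Z)` and `g(p, U)`, the latter
  -- being nonzero near `x`.
  have hfrac : ∀ (x : M) (U : ∀ y : M, TangentSpace (𝓡 n) y) (Y Z : ∀ y : M, perp g p y),
      IsSmoothFieldAt U x → U x = ζ x →
      IsSmoothFieldAt (fun y ↦ (Y y : TangentSpace (𝓡 n) y)) x →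
      IsSmoothFieldAt (fun y ↦ (Z y : TangentSpace (𝓡 n) y)) x →
      ContMDiffAt (𝓡 n) 𝓘(ℝ) ∞ (fun y ↦ η y ![toScreen g p y (Y y), toScreen g p y (Z y)]) x := by
    intro x U Y Z hU hUx hY hZ
    have h1 := (hp x).val g hU
    have h0 : g.val x (p x) (U x) ≠ 0 := by
      rw [hUx]
      exact ne_of_eq_of_ne (he x).pairing one_ne_zero
    refine ((h1.inv₀ h0).mul (hτs x U _ _ hU hY hZ)).congr_of_eventuallyEq ?_
    filter_upwards [h1.continuousAt.eventually_ne h0] with y hy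
    simp only [Pi.mul_apply]
    rw [hmul, inv_mul_cancel_left₀ hy]
  refine ⟨η, fun x Y Z hY hZ ↦ ?_, fun x Y Z hY hZ v ↦ ?_, fun x ↦
    ⟨formContract x (τ x) (ζ x), fun Y Z ↦ (hη x Y Z).symm, hwedge x⟩⟩
  · obtain ⟨U, hU, hUx⟩ := exists_isSmoothFieldAt x (ζ x)
    exact hfrac x U Y Z hU hUx hY hZ
  · obtain ⟨U, hU, hUx⟩ := exists_isSmoothFieldAt x (ζ x)
    have hperp : ∀ Y : ∀ y : M, perp g p y,
        IsSmoothFieldAt (fun y ↦ (Y y : TangentSpace (𝓡 n) y)) x →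
        D (fun y ↦ (Y y : TangentSpace (𝓡 n) y)) x v ∈ perp g p x := by
      intro Y hY
      have h1 := hD x p _ (hp x).isDiffFieldAt hY.isDiffFieldAt v
      have h2 : (fun y ↦ g.val y (p y) (Y y)) = fun _ ↦ 0 := funext fun y ↦ (Y y).2
      rw [h2, mvfderiv_const, hpD x] at h1
      simp only [zero_apply, map_zero, zero_add] at h1
      exact h1.symm
    refine ⟨⟨_, hperp Y hY⟩, ⟨_, hperp Z hZ⟩, rfl, rfl, ?_⟩
    -- The product rule applied to `g(p, U) η(Y, Z)`: the term with `D U` on both sides agrees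
    -- because `p` is parallel, and `g(p, U) = 1` at `x`.
    have h1 := hτD x U _ _ hU hY hZ v
    have h2 : (fun y ↦ τ y ![U y, (Y y : TangentSpace (𝓡 n) y), (Z y : TangentSpace (𝓡 n) y)]) =
        fun y ↦ g.val y (p y) (U y) * η y ![toScreen g p y (Y y), toScreen g p y (Z y)] :=
      funext fun y ↦ hmul y (U y) (Y y) (Z y)
    have h3 : g.val x (p x) (U x) = 1 := by
      rw [hUx]
      exact (he x).pairing
    rw [h2, mvfderiv_fun_mul (((hp x).val g hU).mdifferentiableAt (by simp))
      ((hfrac x U Y Z hU hUx hY hZ).mdifferentiableAt (by simp)), hmul, hUx] at h1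
    have h4 := hD x p U (hp x).isDiffFieldAt hU.isDiffFieldAt v
    rw [hpD x] at h4
    simp only [zero_apply, map_zero, zero_add] at h4
    simp only [add_apply, smul_apply, smul_eq_mul, h4] at h1
    rw [← hUx, h3] at h1
    rw [hη, hη, ← hUx]
    linarith

end Screen

theorem contorsion_neg (x : M) (v u : TangentSpace (𝓡 n) x) :
    contorsion g (fun x ↦ -ξ x) (fun x ↦ -S x) x v u = -contorsion g ξ S x v u := by
  refine g.eq_of_val_eq x fun w ↦ ?_
  simp only [contorsion_apply, map_add, map_sub, map_smul, map_neg, add_apply, sub_apply,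
    smul_apply, neg_apply, LorentzianMetric.val_formVec, smul_eq_mul]
  rw [show (-S x) ![u, v, w] = -S x ![u, v, w] from rfl]
  ring

theorem IsMetricWithParallelTwistorFreeTorsion.exists_constructionData [T2Space M]
    [SimplyConnectedSpace M] (h : IsMetricWithParallelTwistorFreeTorsion g C ξ S)
    (hiso : IsIsotropic g ξ) (hdeg : IsDegenerateForm g S) :
    ∃ (D : AffineConnection n M) (p₀ : ∀ x : M, TangentSpace (𝓡 n) x)
      (η : ∀ x : M, Screen g p₀ x [⋀^Fin 2]→ₗ[ℝ] ℝ)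
      (τ₀ : ∀ x : M, TangentSpace (𝓡 n) x [⋀^Fin 3]→L[ℝ] ℝ) (φ : M → ℝ),
      IsConstructionData g D p₀ η τ₀ φ ∧
      (∀ x, ξ x = Real.exp (-φ x) • p₀ x) ∧ (∀ x, S x = Real.exp (-φ x) • τ₀ x) ∧
      ∀ (x : M) (Y : ∀ y : M, TangentSpace (𝓡 n) y), IsDiffFieldAt Y x →
        C Y x = torsionConnection g D ξ S Y x := by
  obtain ⟨φ, hφ, hdφ⟩ := h.exists_potential hiso hdeg
  have hA := fun x ↦ (h.algebra hiso hdeg x).1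
  have hσ := fun x ↦ (h.algebra hiso hdeg x).2
  have hexp : ContMDiff (𝓡 n) 𝓘(ℝ) ∞ fun y ↦ Real.exp (φ y) := Real.contDiff_exp.contMDiff.comp hφ
  have hexpd : ∀ x, MDifferentiableAt (𝓡 n) 𝓘(ℝ) (fun y ↦ Real.exp (φ y)) x :=
    fun x ↦ hexp.contMDiffAt.mdifferentiableAt (by simp)
  have hdexp : ∀ x v, mvfderiv (𝓡 n) (fun y ↦ Real.exp (φ y)) x v =
      Real.exp (φ x) * g.val x (ξ x) v := fun x v ↦ by
    rw [mvfderiv_exp (hφ.contMDiffAt.mdifferentiableAt (by simp)), hdφ]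
  -- The contorsion is odd in `(ξ, S)`, so subtracting it is again a `torsionConnection`; the
  -- torsion added this way cancels that of `C`, and `D` is the Levi-Civita connection.
  set D : AffineConnection n M :=
    torsionConnection g C (fun x ↦ -ξ x) (fun x ↦ -S x) with hDdef
  have hDC : ∀ (Y : ∀ y : M, TangentSpace (𝓡 n) y) x v,
      D Y x v = C Y x v - contorsion g ξ S x (Y x) v := by
    intro Y x v
    change C Y x v + contorsion g (fun x ↦ -ξ x) (fun x ↦ -S x) x (Y x) v = _
    rw [contorsion_neg]
    abel
  have hξneg : IsSmoothField fun x ↦ -ξ x := fun x ↦ by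
    have := IsSmoothFieldAt.smul (f := fun _ ↦ (-1 : ℝ)) contMDiffAt_const (h.smooth_vectorial x)
    simpa only [neg_one_smul] using this
  have hSneg : IsSmoothThreeForm fun x ↦ -S x := fun x X Y Z hX hY hZ ↦
    (h.smooth_skew x X Y Z hX hY hZ).neg
  have hLC : IsLeviCivita g D := by
    refine ⟨contMDiffCovariantDerivative_torsionConnection h.smooth hξneg hSneg,
      isMetricConnection_torsionConnection h.metric, ?_⟩
    funext x
    ext1 u
    ext1 v
    rw [hDdef, torsion_torsionConnection, h.torsion_eq]
    refine g.eq_of_val_eq x fun w ↦ ?_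
    simp only [map_add, map_sub, map_smul, map_neg, add_apply, sub_apply, smul_apply,
      LorentzianMetric.val_formVec, smul_eq_mul]
    rw [show (-S x) ![u, v, w] = -S x ![u, v, w] from rfl]
    have : g.val x ((0 : TangentSpace (𝓡 n) x →L[ℝ] TangentSpace (𝓡 n) x →L[ℝ]
      TangentSpace (𝓡 n) x) u v) w = 0 := by simp
    refine Eq.trans ?_ this.symm
    ring
  set p₀ : ∀ x : M, TangentSpace (𝓡 n) x := fun x ↦ Real.exp (φ x) • ξ x with hp₀
  set τ₀ : ∀ x : M, TangentSpace (𝓡 n) x [⋀^Fin 3]→L[ℝ] ℝ := fun x ↦ Real.exp (φ x) • S x with hτ₀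
  have hτapp : ∀ x a b c, τ₀ x ![a, b, c] = Real.exp (φ x) * S x ![a, b, c] := fun x a b c ↦ rfl
  have hp₀s : IsSmoothField p₀ := fun x ↦ .smul hexp.contMDiffAt (h.smooth_vectorial x)
  have hp₀iso : IsIsotropic g p₀ := fun x ↦
    ⟨smul_ne_zero (Real.exp_ne_zero _) (hiso x).1, by simp [hp₀, (hiso x).2]⟩
  have hp₀D : IsParallelField D p₀ := by
    intro x
    ext1 v
    rw [hp₀, AffineConnection.map_smul (hexpd x) (h.smooth_vectorial x).isDiffFieldAt, hDC,
      h.isParallelField hiso x, contorsion_self x (hiso x).2 (hA x), hdexp]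
    simp only [zero_apply]
    module
  have hτs : IsSmoothThreeForm τ₀ := h.smooth_skew.smul hexp
  have hτD : IsParallelThreeForm D τ₀ := by
    intro x X Y Z hX hY hZ v
    have h1 := form_contorsion x (hiso x).1 (hiso x).2 (hA x) (hσ x) v (X x) (Y x) (Z x)
    have h2 : mvfderiv (𝓡 n) (fun y ↦ τ₀ y ![X y, Y y, Z y]) x v =
        Real.exp (φ x) * mvfderiv (𝓡 n) (fun y ↦ S y ![X y, Y y, Z y]) x v +
          S x ![X x, Y x, Z x] * mvfderiv (𝓡 n) (fun y ↦ Real.exp (φ y)) x v := by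
      simp only [hτapp]
      rw [mvfderiv_fun_mul (hexpd x)
        ((h.smooth_skew x X Y Z hX hY hZ).mdifferentiableAt (by simp))]
      rfl
    rw [h2, h.isParallelThreeForm hiso x X Y Z hX hY hZ, hdexp]
    simp only [hDC, hτapp]
    simp only [← g.bilin_formMap x (S x), map_sub, LinearMap.sub_apply] at h1 ⊢
    -- The derivative of `e^φ` contributes `g(ξ, v) S`, which cancels the action of the subtracted
    -- contorsion.
    linear_combination Real.exp (φ x) * h1
  obtain ⟨η, hη1, hη2, hη3⟩ := exists_screenForm_of_parallel (g := g) (D := D) (p := p₀) (τ := τ₀)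
    hLC.metric hp₀s hp₀iso hp₀D hτs hτD
    (fun x u v ↦ by
      have h1 : S x ![ξ x, u, v] = 0 := by
        rw [← g.bilin_formMap, hA]; simp
      rw [hτapp, hp₀]
      rw [← g.bilin_formMap] at h1 ⊢
      simp only [map_smul, LinearMap.smul_apply, h1]
      simp)
    (fun x u v w hu hv hw ↦ by
      simp only [hp₀, map_smul, smul_apply, smul_eq_mul, mul_eq_zero, Real.exp_ne_zero,
        false_or] at hu hv hw
      rw [hτapp, hσ x u v w hu hv hw, mul_zero])
  refine ⟨D, p₀, η, τ₀, φ, ⟨hLC, hp₀s, hp₀iso, hp₀D, hη1, hη2, hη3, hτs, hτD, hφ, fun x v ↦ ?_⟩,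
    fun x ↦ ?_, fun x ↦ ?_, fun x Y _ ↦ ?_⟩
  · rw [hdexp]
    simp [hp₀]
  · rw [hp₀, smul_smul, ← Real.exp_add]
    simp
  · rw [hτ₀, smul_smul, ← Real.exp_add]
    simp
  · ext1 v
    change C Y x v = D Y x v + contorsion g ξ S x (Y x) v
    rw [hDC]
    abel

end

theorem mainTheorem4 (n : ℕ) (M : Type*) [TopologicalSpace M] [T2Space M]
    [SecondCountableTopology M] [ChartedSpace (EuclideanSpace ℝ (Fin n)) M]
    [IsManifold (𝓡 n) ∞ M] (g : LorentzianMetric n M) :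
    (∀ (D : AffineConnection n M) (p₀ : ∀ x : M, TangentSpace (𝓡 n) x)
        (η : ∀ x : M, Screen g p₀ x [⋀^Fin 2]→ₗ[ℝ] ℝ)
        (τ₀ : ∀ x : M, TangentSpace (𝓡 n) x [⋀^Fin 3]→L[ℝ] ℝ) (φ : M → ℝ),
      IsConstructionData g D p₀ η τ₀ φ →
      ∀ (ξ : ∀ x : M, TangentSpace (𝓡 n) x)
        (S : ∀ x : M, TangentSpace (𝓡 n) x [⋀^Fin 3]→L[ℝ] ℝ),
        (∀ x, ξ x = Real.exp (-φ x) • p₀ x) → (∀ x, S x = Real.exp (-φ x) • τ₀ x) →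
        IsMetricWithParallelTwistorFreeTorsion g (torsionConnection g D ξ S) ξ S ∧
          IsIsotropic g ξ ∧ IsDegenerateForm g S) ∧
    (SimplyConnectedSpace M →
      ∀ (C : AffineConnection n M) (ξ : ∀ x : M, TangentSpace (𝓡 n) x)
        (S : ∀ x : M, TangentSpace (𝓡 n) x [⋀^Fin 3]→L[ℝ] ℝ),
      IsMetricWithParallelTwistorFreeTorsion g C ξ S → IsIsotropic g ξ → IsDegenerateForm g S →
      ∃ (D : AffineConnection n M) (p₀ : ∀ x : M, TangentSpace (𝓡 n) x)
        (η : ∀ x : M, Screen g p₀ x [⋀^Fin 2]→ₗ[ℝ] ℝ)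
        (τ₀ : ∀ x : M, TangentSpace (𝓡 n) x [⋀^Fin 3]→L[ℝ] ℝ) (φ : M → ℝ),
        IsConstructionData g D p₀ η τ₀ φ ∧
        (∀ x, ξ x = Real.exp (-φ x) • p₀ x) ∧ (∀ x, S x = Real.exp (-φ x) • τ₀ x) ∧
        ∀ (x : M) (Y : ∀ y : M, TangentSpace (𝓡 n) y), IsDiffFieldAt Y x →
          C Y x = torsionConnection g D ξ S Y x) := by
  refine ⟨fun D p₀ η τ₀ φ h ξ S hξ hS ↦ h.torsionConnection_spec hξ hS, ?_⟩
  intro _ C ξ S h hiso hdeg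
  exact h.exists_constructionData hiso hdeg

end
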